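/- Let $D\subset\mathbb{C}$ be the open unit disc with the hyperbolic metric $4(1-|z|^2)^{-2}|dz|^2$, and realise the universal covering group $\tilde{\mathrm{Sl}}(2,\mathbb{R})$ on the manifold $\mathbb{R}\times D$ by the group law $$(\alpha,z)\cdot(\beta,w)=\Bigl(\alpha+\beta-2\arg(1+\bar z e^{i\alpha}w),\ \frac{e^{i\alpha}w+z}{1+\bar z e^{i\alpha}w}\Bigr)$$ (principal argument), so that $(\alpha,z)$ lies over the orientation preserving isometry $w\mapsto (e^{i\alpha}w+z)/(1+\bar z e^{i\alpha}w)$ of $D$. Let $\mathcal{D}_e$ be the group of diffeomorphisms of $\tilde{\mathrm{Sl}}(2,\mathbb{R})$ generated by the left translations and the automorphisms $(\alpha,z)\mapsto(\alpha,e^{i\theta}z)$, $\theta\in\mathbb{R}$, $(\alpha,z)\mapsto(-\alpha,-\bar z)$ and $(\alpha,z)\mapsto(-\alpha,\bar z)$. It contains the translations $T_\theta(\alpha,z)=(\alpha+\theta,z)$, which form a subgroup identified with $\mathbb{R}$, and there is a homomorphism $p:\mathcal{D}_e\to\mathrm{Isom}(D)$ given by $p[\phi](z)=\pi_2(\phi(0,z))$,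 where $\pi_2(\alpha,z)=z$. Let $\Gamma\subset\mathcal{D}_e$ be a subgroup acting freely and properly discontinuously on $\tilde{\mathrm{Sl}}(2,\mathbb{R})$ such that $\tilde{\mathrm{Sl}}(2,\mathbb{R})/\Gamma$ is compact. Then: 1. $p(\Gamma)$ is a discrete subgroup of the Lie group $\mathrm{Isom}(D)$. 2. $D/p(\Gamma)$ is compact. 3. $\Gamma\cap\mathbb{R}$ is an infinite cyclic group. 4. The quotient $\tilde{\mathrm{Sl}}(2,\mathbb{R})/\Gamma$, with the smooth structure (Hausdorff and second countable) for which the projection from $\tilde{\mathrm{Sl}}(2,\mathbb{R})$ is a local diffeomorphism, is a Seifert fibred space whose base is, as an orbifold, the compact hyperbolic orbifold $D/p(\Gamma)$. Here a $3$-manifold is a Seifert fibred space if it is a disjoint union of circles (the fibres) such that each fibre has an open neighbourhood which is a union of fibres and is diffeomorphic, by a map taking fibres to fibres, to an open solid torus obtained from a cylinder by identifying its ends after a rotation by an angle $2\pi\nu$, $\nu\in\mathbb{Q}$, fibred by the images of the lines parallel to the axis. Its base is the space of fibres; the cross-sectional disc of each such solid torus, with the group generated by the rotation by $2\pi\nu$,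 is an orbifold chart of it, and an isomorphism of orbifolds is a homeomorphism which lifts locally to diffeomorphisms between charts. -/

import Mathlib

open Complex Topology Manifold
open scoped ContDiff ComplexConjugate

noncomputable section

/-! ### The hyperbolic plane in the disc model and its isometry group -/

/-- The open unit disc `D`, an open submanifold of `ℂ`. -/
def Disc : TopologicalSpace.Opens ℂ := ⟨Metric.ball 0 1, Metric.isOpen_ball⟩

namespace Disc

theorem norm_lt (z : Disc) : ‖(z : ℂ)‖ < 1 := by
  have h := z.2
  simpa [Disc] using h

theorem normSq_lt (z : Disc) : normSq (z : ℂ) < 1 := by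
  rw [normSq_eq_norm_sq]
  nlinarith [norm_lt z, norm_nonneg (z : ℂ)]

/-- Points of the disc from complex numbers with `normSq < 1`. -/
def mk (z : ℂ) (h : normSq z < 1) : Disc := ⟨z, by
  rw [normSq_eq_norm_sq] at h
  have : ‖z‖ < 1 := by nlinarith [norm_nonneg z]
  simpa [Disc] using this⟩

@[simp] theorem coe_mk (z : ℂ) (h : normSq z < 1) : ((mk z h : Disc) : ℂ) = z := rfl

/-- The centre of the disc. -/
def zero : Disc := mk 0 (by simp)

/-- The distance of the metric `4 (1 - x ^ 2 - y ^ 2)⁻² (dx ^ 2 + dy ^ 2)` of curvature `-1`. -/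
def hypDist (z w : Disc) : ℝ :=
  2 * Real.arsinh (‖(z : ℂ) - w‖ / √((1 - normSq (z : ℂ)) * (1 - normSq (w : ℂ))))

/-- The unit complex number `exp (i α)`. -/
def unit (α : ℝ) : ℂ := exp (α * I)

@[simp] theorem unit_zero : unit 0 = 1 := by simp [unit]

theorem unit_add (α β : ℝ) : unit (α + β) = unit α * unit β := by
  simp [unit, add_mul, exp_add]

@[simp] theorem conj_unit (α : ℝ) : conj (unit α) = unit (-α) := by
  simp [unit, ← exp_conj]

@[simp] theorem normSq_unit (α : ℝ) : normSq (unit α) = 1 := by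
  rw [normSq_eq_norm_sq]; simp [unit, norm_exp_ofReal_mul_I]

theorem unit_mul_neg (α : ℝ) : unit α * unit (-α) = 1 := by
  rw [← unit_add]; simp

@[simp] theorem unit_ne_zero (α : ℝ) : unit α ≠ 0 := exp_ne_zero _

/-- Rotation of the disc about its centre by the angle `θ`. -/
def rot (θ : ℝ) (z : Disc) : Disc := mk (unit θ * z) (by simpa using Disc.normSq_lt z)

@[simp] theorem coe_rot (θ : ℝ) (z : Disc) : ((rot θ z : Disc) : ℂ) = unit θ * z := rfl

/-- Complex conjugation on the disc. -/
def conjD (z : Disc) : Disc := mk (conj (z : ℂ)) (by simpa using Disc.normSq_lt z)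

@[simp] theorem coe_conjD (z : Disc) : ((conjD z : Disc) : ℂ) = conj (z : ℂ) := rfl

/-- The denominator of the Möbius transformation below. -/
def den (α : ℝ) (a z : Disc) : ℂ := 1 + conj (a : ℂ) * unit α * z

theorem den_re_pos (α : ℝ) (a z : Disc) : 0 < (den α a z).re := by
  have h : ‖conj (a : ℂ) * unit α * z‖ < 1 := by
    rw [norm_mul, norm_mul, norm_conj]
    have : ‖unit α‖ = 1 := by simp [unit, norm_exp_ofReal_mul_I]
    rw [this, mul_one]
    nlinarith [Disc.norm_lt a, Disc.norm_lt z, norm_nonneg (a : ℂ), norm_nonneg (z : ℂ)]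
  have h2 := abs_re_le_norm (conj (a : ℂ) * unit α * z)
  have h3 := neg_le_of_abs_le h2
  simp only [den, add_re, one_re]
  linarith

theorem den_ne_zero (α : ℝ) (a z : Disc) : den α a z ≠ 0 := by
  intro h
  have := den_re_pos α a z
  simp [h] at this

theorem abs_arg_den_lt (α : ℝ) (a z : Disc) : |arg (den α a z)| < Real.pi / 2 :=
  abs_arg_lt_pi_div_two_iff.2 (Or.inl (den_re_pos α a z))

theorem mob_aux (α : ℝ) (a z : Disc) :
    normSq (den α a z) - normSq (unit α * z + a) =
      (1 - normSq (a : ℂ)) * (1 - normSq (z : ℂ)) := by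
  have hu := normSq_unit α
  simp only [den, normSq_apply, add_re, add_im, mul_re, mul_im, conj_re, conj_im, one_re,
    one_im] at hu ⊢
  linear_combination
    (((a : ℂ).re ^ 2 + (a : ℂ).im ^ 2) - 1) * ((z : ℂ).re ^ 2 + (z : ℂ).im ^ 2) * hu

theorem mob_sub (α : ℝ) (a z : Disc) :
    1 - normSq ((unit α * z + a) / den α a z) =
      (1 - normSq (a : ℂ)) * (1 - normSq (z : ℂ)) / normSq (den α a z) := by
  have h : normSq (den α a z) ≠ 0 := by simpa using den_ne_zero α a z
  rw [normSq_div, ← mob_aux]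
  field_simp

/-- The orientation preserving isometry `z ↦ (e^{iα} z + a) / (1 + conj a * e^{iα} z)`. It maps the
vector `∂ₓ` at the centre to a vector of argument `α` at the point `a`. -/
def mob (α : ℝ) (a z : Disc) : Disc := mk ((unit α * z + a) / den α a z) (by
  have h := mob_sub α a z
  have h1 := Disc.normSq_lt a
  have h2 := Disc.normSq_lt z
  have h3 : 0 < normSq (den α a z) := normSq_pos.2 (den_ne_zero α a z)
  have h4 : 0 < (1 - normSq (a : ℂ)) * (1 - normSq (z : ℂ)) / normSq (den α a z) :=
    div_pos (mul_pos (by linarith) (by linarith)) h3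
  linarith)

@[simp] theorem coe_mob (α : ℝ) (a z : Disc) :
    ((mob α a z : Disc) : ℂ) = (unit α * z + a) / den α a z := rfl

theorem hypDist_mob (α : ℝ) (a z w : Disc) : hypDist (mob α a z) (mob α a w) = hypDist z w := by
  have hz := den_ne_zero α a z
  have hw := den_ne_zero α a w
  have ha : 0 < 1 - normSq (a : ℂ) := by linarith [Disc.normSq_lt a]
  have e : ((mob α a z : Disc) : ℂ) - (mob α a w : Disc) =
      unit α * (z - w) * ((1 - normSq (a : ℂ) : ℝ) : ℂ) / (den α a z * den α a w) := by
    simp only [coe_mob]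
    rw [div_sub_div _ _ hz hw]
    congr 1
    push_cast
    rw [normSq_eq_conj_mul_self]
    simp only [den]
    ring
  have hu : ‖unit α‖ = 1 := by simp [unit, norm_exp_ofReal_mul_I]
  have e2 : ‖((mob α a z : Disc) : ℂ) - (mob α a w : Disc)‖ =
      ‖(z : ℂ) - w‖ * ((1 - normSq (a : ℂ)) / (‖den α a z‖ * ‖den α a w‖)) := by
    rw [e, norm_div, norm_mul, norm_mul, norm_mul, hu, norm_real, Real.norm_of_nonneg ha.le]
    ring
  have e3 : (1 - normSq ((mob α a z : Disc) : ℂ)) * (1 - normSq ((mob α a w : Disc) : ℂ)) =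
      ((1 - normSq (z : ℂ)) * (1 - normSq (w : ℂ))) *
        ((1 - normSq (a : ℂ)) / (‖den α a z‖ * ‖den α a w‖)) ^ 2 := by
    simp only [coe_mob, mob_sub]
    rw [normSq_eq_norm_sq (den α a z), normSq_eq_norm_sq (den α a w)]
    have h1 : ‖den α a z‖ ≠ 0 := by simpa using hz
    have h2 : ‖den α a w‖ ≠ 0 := by simpa using hw
    field_simp
  have hc : 0 < (1 - normSq (a : ℂ)) / (‖den α a z‖ * ‖den α a w‖) :=
    div_pos ha (mul_pos (norm_pos_iff.2 hz) (norm_pos_iff.2 hw))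
  unfold hypDist
  rw [e2, e3, Real.sqrt_mul' _ (sq_nonneg _), Real.sqrt_sq hc.le, mul_div_mul_right _ _ hc.ne']

theorem hypDist_rot (θ : ℝ) (z w : Disc) : hypDist (rot θ z) (rot θ w) = hypDist z w := by
  have hu : ‖unit θ‖ = 1 := by simp [unit, norm_exp_ofReal_mul_I]
  unfold hypDist
  simp only [coe_rot, ← mul_sub, norm_mul, hu, one_mul, normSq_mul, normSq_unit]

theorem hypDist_conjD (z w : Disc) : hypDist (conjD z) (conjD w) = hypDist z w := by
  unfold hypDist
  simp only [coe_conjD, ← map_sub, norm_conj, normSq_conj]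

end Disc

/-- The isometry group of the hyperbolic plane (disc model). -/
def HypIsom : Subgroup (Equiv.Perm Disc) where
  carrier := {f | ∀ z w, Disc.hypDist (f z) (f w) = Disc.hypDist z w}
  mul_mem' {f g} hf hg z w := (hf (g z) (g w)).trans (hg z w)
  one_mem' _ _ := rfl
  inv_mem' {f} hf z w := by
    have h := hf (f⁻¹ z) (f⁻¹ w)
    simpa using h.symm

/-- The Lie group topology on the isometry group of the hyperbolic plane: the topology of pointwise
convergence, which on an isometry group coincides with the compact-open topology. -/
instance : TopologicalSpace HypIsom :=
  TopologicalSpace.induced (fun f z => (f : Equiv.Perm Disc) z)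
    (inferInstance : TopologicalSpace (Disc → Disc))

/-! ### The universal covering group of `SL(2, ℝ)` -/

/-- The universal covering group of `SL(2, ℝ)`, on the manifold `ℝ × D`. The pair `(α, z)` lies over
the unit tangent vector of argument `α` at the point `z` of the disc, that is, over the orientation
preserving isometry `Disc.mob α z` in `PSL(2, ℝ)`. -/
def SL2Cover : Type := ℝ × Disc

namespace SL2Cover

instance : TopologicalSpace SL2Cover := inferInstanceAs (TopologicalSpace (ℝ × Disc))

instance : ChartedSpace (ModelProd ℝ ℂ) SL2Cover :=
  inferInstanceAs (ChartedSpace (ModelProd ℝ ℂ) (ℝ × Disc))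

/-- The point `(α, z)`. -/
def mk (α : ℝ) (z : Disc) : SL2Cover := (α, z)

/-- The first component `α` of `(α, z)`. -/
def ang (x : SL2Cover) : ℝ := Prod.fst x

/-- The second component `π₂ (α, z) = z`. -/
def pt (x : SL2Cover) : Disc := Prod.snd x

@[simp] theorem ang_mk (α : ℝ) (z : Disc) : (mk α z).ang = α := rfl

@[simp] theorem pt_mk (α : ℝ) (z : Disc) : (mk α z).pt = z := rfl

theorem ext {x y : SL2Cover} (h₁ : x.ang = y.ang) (h₂ : x.pt = y.pt) : x = y := Prod.ext h₁ h₂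

/-- The multiplication for which `(α, z) ↦ Disc.mob α z` is a homomorphism and `(0, 0)` the
identity. The first component is the argument `α + β - 2 arg (1 + conj z * e^{iα} w)` of the
derivative at the centre of the composition of `Disc.mob α z` and `Disc.mob β w`. -/
instance : Mul SL2Cover :=
  ⟨fun x y =>
    mk (x.ang + y.ang - 2 * arg (Disc.den x.ang x.pt y.pt)) (Disc.mob x.ang x.pt y.pt)⟩

instance : One SL2Cover := ⟨mk 0 Disc.zero⟩

instance : Inv SL2Cover := ⟨fun x => mk (-x.ang) (Disc.rot (Real.pi - x.ang) x.pt)⟩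

@[simp] theorem mul_ang (x y : SL2Cover) :
    (x * y).ang = x.ang + y.ang - 2 * arg (Disc.den x.ang x.pt y.pt) := rfl

@[simp] theorem mul_pt (x y : SL2Cover) : (x * y).pt = Disc.mob x.ang x.pt y.pt := rfl

@[simp] theorem one_ang : (1 : SL2Cover).ang = 0 := rfl

@[simp] theorem one_pt : (1 : SL2Cover).pt = Disc.zero := rfl

@[simp] theorem inv_ang (x : SL2Cover) : (x⁻¹).ang = -x.ang := rfl

@[simp] theorem inv_pt (x : SL2Cover) : (x⁻¹).pt = Disc.rot (Real.pi - x.ang) x.pt := rfl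

theorem unit_arg (c : ℂ) (hc : c ≠ 0) : Disc.unit (-(2 * arg c)) = conj c / c := by
  have h : c = ‖c‖ * Disc.unit (arg c) := (norm_mul_exp_arg_mul_I c).symm
  have hn : (‖c‖ : ℂ) ≠ 0 := by simpa using hc
  have h' : conj c = ‖c‖ * Disc.unit (-arg c) := by
    conv_lhs => rw [h]
    rw [map_mul, conj_ofReal, Disc.conj_unit]
  have h2 : Disc.unit (-arg c) = Disc.unit (-(2 * arg c)) * Disc.unit (arg c) := by
    rw [← Disc.unit_add]; congr 1; ring
  rw [eq_div_iff hc, h', h2]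
  generalize Disc.unit (-(2 * arg c)) = v
  conv_lhs => rw [h]
  ring

theorem unit_mul_ang (x y : SL2Cover) : Disc.unit (x * y).ang =
    Disc.unit x.ang * Disc.unit y.ang * (conj (Disc.den x.ang x.pt y.pt) / Disc.den x.ang x.pt y.pt) := by
  rw [mul_ang, sub_eq_add_neg, Disc.unit_add, Disc.unit_add, unit_arg _ (Disc.den_ne_zero _ _ _)]

theorem den_mul (x y : SL2Cover) (u : Disc) :
    Disc.den x.ang x.pt y.pt * Disc.den (x * y).ang (x * y).pt u =
      Disc.den y.ang y.pt u * Disc.den x.ang x.pt (Disc.mob y.ang y.pt u) := by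
  have h1 := Disc.den_ne_zero x.ang x.pt y.pt
  have h2 := Disc.den_ne_zero y.ang y.pt u
  have h1' : conj (Disc.den x.ang x.pt y.pt) ≠ 0 := by simpa using h1
  have e := Disc.unit_mul_neg x.ang
  have hA : Disc.den x.ang x.pt y.pt * Disc.den (x * y).ang (x * y).pt u =
      Disc.den x.ang x.pt y.pt +
        conj (Disc.unit x.ang * y.pt + x.pt) * Disc.unit x.ang * Disc.unit y.ang * u := by
    conv_lhs => rw [Disc.den.eq_1 (x * y).ang, unit_mul_ang, mul_pt, Disc.coe_mob, map_div₀]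
    field_simp
  have hB : Disc.den y.ang y.pt u * Disc.den x.ang x.pt (Disc.mob y.ang y.pt u) =
      Disc.den y.ang y.pt u + conj (x.pt : ℂ) * Disc.unit x.ang * (Disc.unit y.ang * u + y.pt) := by
    conv_lhs => rw [Disc.den.eq_1 x.ang, Disc.coe_mob]
    field_simp
  rw [hA, hB]
  simp only [Disc.den, map_add, map_mul, Disc.conj_unit]
  linear_combination conj (y.pt : ℂ) * Disc.unit y.ang * u * e

/-- The second component of the multiplication is composition of isometries. -/
theorem mob_mul (x y : SL2Cover) (u : Disc) :
    Disc.mob (x * y).ang (x * y).pt u = Disc.mob x.ang x.pt (Disc.mob y.ang y.pt u) := by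
  have h1 := Disc.den_ne_zero x.ang x.pt y.pt
  have h2 := Disc.den_ne_zero y.ang y.pt u
  have h3 := Disc.den_ne_zero (x * y).ang (x * y).pt u
  have h4 := Disc.den_ne_zero x.ang x.pt (Disc.mob y.ang y.pt u)
  have e := Disc.unit_mul_neg x.ang
  apply Subtype.ext
  rw [Disc.coe_mob, Disc.coe_mob, ← mul_div_mul_left _ _ h1, den_mul,
    ← mul_div_mul_left (_ + _) (Disc.den x.ang x.pt (Disc.mob y.ang y.pt u)) h2]
  congr 1
  rw [unit_mul_ang, mul_pt, Disc.coe_mob, Disc.coe_mob]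
  field_simp
  simp only [Disc.den, map_add, map_mul, Disc.conj_unit, map_one, conj_conj]
  linear_combination (x.pt : ℂ) * conj (y.pt : ℂ) * Disc.unit y.ang * u * e

theorem arg_den_mul (x y : SL2Cover) (u : Disc) :
    arg (Disc.den x.ang x.pt y.pt) + arg (Disc.den (x * y).ang (x * y).pt u) =
      arg (Disc.den y.ang y.pt u) + arg (Disc.den x.ang x.pt (Disc.mob y.ang y.pt u)) := by
  have h1 := abs_lt.1 (Disc.abs_arg_den_lt x.ang x.pt y.pt)
  have h2 := abs_lt.1 (Disc.abs_arg_den_lt (x * y).ang (x * y).pt u)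
  have h3 := abs_lt.1 (Disc.abs_arg_den_lt y.ang y.pt u)
  have h4 := abs_lt.1 (Disc.abs_arg_den_lt x.ang x.pt (Disc.mob y.ang y.pt u))
  rw [← (arg_mul_eq_add_arg_iff (Disc.den_ne_zero _ _ _) (Disc.den_ne_zero _ _ _)).2
      ⟨by linarith, by linarith⟩,
    ← (arg_mul_eq_add_arg_iff (Disc.den_ne_zero _ _ _) (Disc.den_ne_zero _ _ _)).2
      ⟨by linarith, by linarith⟩, den_mul]

instance : Group SL2Cover :=
  Group.ofLeftAxioms
    (fun x y u => by
      apply ext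
      · have h := arg_den_mul x y u.pt
        simp only [mul_ang, mul_pt] at h ⊢
        linarith
      · exact mob_mul x y u.pt)
    (fun x => by
      apply ext
      · simp [Disc.den, Disc.zero]
      · apply Subtype.ext
        simp [Disc.den, Disc.zero])
    (fun x => by
      have e : Disc.unit (Real.pi - x.ang) = -Disc.unit (-x.ang) := by
        rw [sub_eq_add_neg, Disc.unit_add]
        simp [Disc.unit, exp_pi_mul_I]
      have h : Disc.den (x⁻¹).ang (x⁻¹).pt x.pt = ((1 - normSq (x.pt : ℂ) : ℝ) : ℂ) := by
        have e' := Disc.unit_mul_neg x.ang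
        push_cast
        rw [normSq_eq_conj_mul_self]
        simp only [Disc.den, inv_ang, inv_pt, Disc.coe_rot, e, map_mul, map_neg,
          Disc.conj_unit, neg_neg]
        linear_combination -(conj (x.pt : ℂ) * x.pt) * e'
      apply ext
      · rw [mul_ang, h, arg_ofReal_of_nonneg (by linarith [Disc.normSq_lt x.pt])]
        simp
      · apply Subtype.ext
        rw [mul_pt, Disc.coe_mob]
        simp [e, Disc.zero])

/-! ### The group `D_e` of diffeomorphisms -/

/-- The Lie group automorphism `(α, z) ↦ (α, e^{iθ} z)`. Its differential at the identity fixes `E₁`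
and rotates the plane spanned by `E₂` and `E₃` by the angle `θ`. -/
def rotAut (θ : ℝ) : SL2Cover ≃* SL2Cover where
  toFun x := mk x.ang (Disc.rot θ x.pt)
  invFun x := mk x.ang (Disc.rot (-θ) x.pt)
  left_inv x := by
    apply ext
    · rfl
    · apply Subtype.ext
      simp [← mul_assoc, ← Disc.unit_add]
  right_inv x := by
    apply ext
    · rfl
    · apply Subtype.ext
      simp [← mul_assoc, ← Disc.unit_add]
  map_mul' x y := by
    have e := Disc.unit_mul_neg θ
    have h : Disc.den x.ang (Disc.rot θ x.pt) (Disc.rot θ y.pt) = Disc.den x.ang x.pt y.pt := by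
      simp only [Disc.den, Disc.coe_rot, map_mul, Disc.conj_unit]
      linear_combination conj (x.pt : ℂ) * Disc.unit x.ang * y.pt * e
    apply ext
    · change _ = x.ang + y.ang - 2 * arg (Disc.den x.ang (Disc.rot θ x.pt) (Disc.rot θ y.pt))
      rw [h]
      rfl
    · apply Subtype.ext
      change Disc.unit θ * (Disc.mob x.ang x.pt y.pt : ℂ) =
        (Disc.mob x.ang (Disc.rot θ x.pt) (Disc.rot θ y.pt) : ℂ)
      rw [Disc.coe_mob, Disc.coe_mob, h, Disc.coe_rot, Disc.coe_rot]
      ring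

/-- The Lie group automorphism `(α, x, y) ↦ (-α, x, -y)`. Its differential at the identity fixes
`E₂` and changes the signs of `E₁` and `E₃`. -/
def conjAut : SL2Cover ≃* SL2Cover where
  toFun x := mk (-x.ang) (Disc.conjD x.pt)
  invFun x := mk (-x.ang) (Disc.conjD x.pt)
  left_inv x := by
    apply ext
    · exact neg_neg _
    · apply Subtype.ext
      simp
  right_inv x := by
    apply ext
    · exact neg_neg _
    · apply Subtype.ext
      simp
  map_mul' x y := by
    have h : Disc.den (-x.ang) (Disc.conjD x.pt) (Disc.conjD y.pt) = conj (Disc.den x.ang x.pt y.pt) := by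
      simp [Disc.den]
    have ha : arg (Disc.den x.ang x.pt y.pt) ≠ Real.pi := by
      have := abs_lt.1 (Disc.abs_arg_den_lt x.ang x.pt y.pt)
      linarith [Real.pi_pos]
    apply ext
    · change -(x.ang + y.ang - 2 * arg (Disc.den x.ang x.pt y.pt)) =
        -x.ang + -y.ang - 2 * arg (Disc.den (-x.ang) (Disc.conjD x.pt) (Disc.conjD y.pt))
      rw [h, arg_conj, if_neg ha]
      ring
    · apply Subtype.ext
      change conj (Disc.mob x.ang x.pt y.pt : ℂ) =
        (Disc.mob (-x.ang) (Disc.conjD x.pt) (Disc.conjD y.pt) : ℂ)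
      rw [Disc.coe_mob, Disc.coe_mob, h]
      simp

/-- The three Lie group automorphisms whose differentials at the identity change the signs of two
of the `Eᵢ` and fix the remaining one:
`(α, z) ↦ (α, -z)`, `(α, x, y) ↦ (-α, -x, y)` and `(α, x, y) ↦ (-α, x, -y)`. -/
def phi : Fin 3 → (SL2Cover ≃* SL2Cover) :=
  ![rotAut Real.pi, conjAut.trans (rotAut Real.pi), conjAut]

/-- The translation `(α, z) ↦ (α + θ, z)`. -/
def transPerm (θ : ℝ) : Equiv.Perm SL2Cover where
  toFun x := mk (x.ang + θ) x.pt
  invFun x := mk (x.ang - θ) x.pt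
  left_inv _ := ext (add_sub_cancel_right _ _) rfl
  right_inv _ := ext (sub_add_cancel _ _) rfl

end SL2Cover

open SL2Cover

/-- The group `D_e` of diffeomorphisms of the universal cover of `SL(2, ℝ)`, generated by the left
translations, the three automorphisms `phi i` and the automorphisms `rotAut θ`. -/
def De : Subgroup (Equiv.Perm SL2Cover) :=
  Subgroup.closure
    ({f | ∃ g : SL2Cover, f = Equiv.mulLeft g} ∪ {f | ∃ i, f = (phi i).toEquiv} ∪
      {f | ∃ θ, f = (rotAut θ).toEquiv})

namespace De

/-- Every element of `D_e` covers an isometry of the hyperbolic plane. -/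
theorem exists_isom (ψ : De) :
    ∃ f : HypIsom, ∀ x : SL2Cover, ((ψ : Equiv.Perm SL2Cover) x).pt = (f : Equiv.Perm Disc) x.pt := by
  have key : ∀ (F : Equiv.Perm SL2Cover) (f g : Disc → Disc),
      (∀ x, (F x).pt = f x.pt) → (∀ x, (F⁻¹ x).pt = g x.pt) →
      (∀ z w, Disc.hypDist (f z) (f w) = Disc.hypDist z w) →
      ∃ f : HypIsom, ∀ x, (F x).pt = (f : Equiv.Perm Disc) x.pt := by
    intro F f g hf hg hd
    refine ⟨⟨⟨f, g, fun z => ?_, fun z => ?_⟩, hd⟩, hf⟩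
    · have h := hg (F (mk 0 z))
      rw [hf, show F⁻¹ (F (mk 0 z)) = mk 0 z from F.symm_apply_apply _] at h
      exact h.symm
    · have h := hf (F⁻¹ (mk 0 z))
      rw [hg, show F (F⁻¹ (mk 0 z)) = mk 0 z from F.apply_symm_apply _] at h
      exact h.symm
  have hrot : ∀ θ, ∃ f : HypIsom, ∀ x, ((rotAut θ).toEquiv x).pt = (f : Equiv.Perm Disc) x.pt :=
    fun θ => key _ (Disc.rot θ) (Disc.rot (-θ)) (fun _ => rfl) (fun _ => rfl) (Disc.hypDist_rot θ)
  have hconj : ∃ f : HypIsom, ∀ x, (conjAut.toEquiv x).pt = (f : Equiv.Perm Disc) x.pt :=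
    key _ Disc.conjD Disc.conjD (fun _ => rfl) (fun _ => rfl) Disc.hypDist_conjD
  obtain ⟨ψ, hψ⟩ := ψ
  dsimp only
  induction hψ using Subgroup.closure_induction with
  | mem F hF =>
    rcases hF with (⟨g, rfl⟩ | ⟨i, rfl⟩) | ⟨θ, rfl⟩
    · exact key _ (Disc.mob g.ang g.pt) (Disc.mob g⁻¹.ang g⁻¹.pt) (fun _ => rfl) (fun _ => rfl)
        (Disc.hypDist_mob _ _)
    · fin_cases i
      · exact hrot Real.pi
      · obtain ⟨f, hf⟩ := hrot Real.pi
        obtain ⟨g, hg⟩ := hconj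
        refine ⟨f * g, fun x => ?_⟩
        change ((rotAut Real.pi).toEquiv (conjAut.toEquiv x)).pt =
          (f : Equiv.Perm Disc) ((g : Equiv.Perm Disc) x.pt)
        rw [hf, hg]
      · exact hconj
    · exact hrot θ
  | one => exact ⟨1, fun _ => rfl⟩
  | mul F G _ _ hF hG =>
    obtain ⟨f, hf⟩ := hF
    obtain ⟨g, hg⟩ := hG
    refine ⟨f * g, fun x => ?_⟩
    change (F (G x)).pt = (f : Equiv.Perm Disc) ((g : Equiv.Perm Disc) x.pt)
    rw [hf, hg]
  | inv F _ hF =>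
    obtain ⟨f, hf⟩ := hF
    refine ⟨f⁻¹, fun x => ?_⟩
    have h := hf (F⁻¹ x)
    rw [show F (F⁻¹ x) = x from F.apply_symm_apply _] at h
    change _ = (f : Equiv.Perm Disc)⁻¹ x.pt
    rw [h]
    exact ((f : Equiv.Perm Disc).symm_apply_apply _).symm

/-- The function `p ψ z = π₂ (ψ (0, z))`. -/
def pFun (ψ : De) (z : Disc) : Disc := ((ψ : Equiv.Perm SL2Cover) (mk 0 z)).pt

/-- `π₂ (ψ (α, z))` does not depend on `α`. -/
theorem pt_apply (ψ : De) (x : SL2Cover) : ((ψ : Equiv.Perm SL2Cover) x).pt = pFun ψ x.pt := by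
  obtain ⟨f, hf⟩ := exists_isom ψ
  rw [hf, pFun, hf, pt_mk]

theorem pFun_mul (ψ χ : De) (z : Disc) : pFun (ψ * χ) z = pFun ψ (pFun χ z) :=
  pt_apply ψ ((χ : Equiv.Perm SL2Cover) (mk 0 z))

theorem pFun_one (z : Disc) : pFun 1 z = z := rfl

/-- The homomorphism `p` from `D_e` to the isometry group of the hyperbolic plane,
`p ψ z = π₂ (ψ (0, z))`. -/
def p : De →* HypIsom where
  toFun ψ := ⟨⟨pFun ψ, pFun ψ⁻¹,
      fun z => by rw [← pFun_mul, inv_mul_cancel, pFun_one],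
      fun z => by rw [← pFun_mul, mul_inv_cancel, pFun_one]⟩, fun z w => by
    obtain ⟨f, hf⟩ := exists_isom ψ
    change Disc.hypDist (pFun ψ z) (pFun ψ w) = _
    rw [pFun, pFun, hf, hf]
    exact f.2 z w⟩
  map_one' := Subtype.ext (Equiv.ext pFun_one)
  map_mul' ψ χ := Subtype.ext (Equiv.ext (pFun_mul ψ χ))

theorem transPerm_mem (θ : ℝ) : transPerm θ ∈ De := by
  have h : transPerm θ =
      Equiv.mulLeft (mk θ Disc.zero) * (rotAut (-θ)).toEquiv := by
    ext1 x
    apply SL2Cover.ext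
    · change x.ang + θ = θ + x.ang - 2 * arg (Disc.den θ Disc.zero (Disc.rot (-θ) x.pt))
      simp [Disc.den, Disc.zero, add_comm]
    · apply Subtype.ext
      change (x.pt : ℂ) = (Disc.mob θ Disc.zero (Disc.rot (-θ) x.pt) : ℂ)
      simp [Disc.den, Disc.zero, ← mul_assoc, Disc.unit_mul_neg]
  rw [h]
  exact mul_mem (Subgroup.subset_closure (Or.inl (Or.inl ⟨_, rfl⟩)))
    (Subgroup.subset_closure (Or.inr ⟨_, rfl⟩))

/-- The embedding of `ℝ` in `D_e` as the group of the translations `(α, z) ↦ (α + θ, z)`. -/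
def trans : Multiplicative ℝ →* De where
  toFun θ := ⟨transPerm θ.toAdd, transPerm_mem _⟩
  map_one' := Subtype.ext (Equiv.ext fun x => SL2Cover.ext (add_zero x.ang) rfl)
  map_mul' θ η := Subtype.ext (Equiv.ext fun x => SL2Cover.ext (by
    change x.ang + (θ.toAdd + η.toAdd) = x.ang + η.toAdd + θ.toAdd
    ring) rfl)

end De

/-! ### Seifert fibrations -/

section Seifert

variable {E : Type*} [NormedAddCommGroup E] [NormedSpace ℝ E] {H : Type*} [TopologicalSpace H]
  (I : ModelWithCorners ℝ E H) {M : Type*} [TopologicalSpace M] [ChartedSpace H M]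

/-- The cylinder `D × ℝ` modulo `(w, s) ~ (e^{2πiν} w, s + 1)` is the standard fibred solid torus,
obtained from the cylinder `D × [0, 1]` by identifying the ends after a rotation by the rational
angle `2πν`; its circle fibres are the images of the lines `{w} × ℝ`. The predicate says that `Ψ`
induces a diffeomorphism from this solid torus onto an open subset of `M` which takes the circle
fibres to equivalence classes of `r` (the fibres of `M`). -/
structure IsFibredSolidTorus (r : Setoid M) (ν : ℚ) (Ψ : Disc × ℝ → M) : Prop where
  isLocalDiffeomorph : IsLocalDiffeomorph (𝓘(ℝ, ℂ).prod 𝓘(ℝ, ℝ)) I ∞ Ψ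
  eq_iff : ∀ w s w' s', Ψ (w, s) = Ψ (w', s') ↔
    ∃ n : ℤ, w' = Disc.rot (2 * Real.pi * ν * n) w ∧ s' = s + n
  fibre_iff : ∀ w s y, r (Ψ (w, s)) y ↔ ∃ s', Ψ (w, s') = y

/-- The equivalence classes of `r` are the fibres of a Seifert fibration of the manifold `M`: they
are circles, and every fibre has an open neighbourhood which is a union of fibres and is isomorphic
to a standard fibred solid torus. -/
structure IsSeifertFibration (r : Setoid M) : Prop where
  circle : ∀ x : M, Nonempty ({y : M | r x y} ≃ₜ Circle)
  exists_solidTorus : ∀ x : M, ∃ (ν : ℚ) (Ψ : Disc × ℝ → M),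
    IsFibredSolidTorus I r ν Ψ ∧ {y : M | r x y} ⊆ Set.range Ψ

/-- The base of the Seifert fibration `r` is, as an orbifold, the quotient of the hyperbolic plane
by the group `P` of isometries. The base is the space of fibres, and a fibred solid torus `Ψ` gives
the orbifold chart `w ↦ [Ψ (w, 0)]` of it, with the group generated by the rotation by `2πν`.
An orbifold isomorphism is a homeomorphism of the underlying spaces which lifts locally to
diffeomorphisms of charts. -/
def HasBaseOrbifold (r : Setoid M) (P : Subgroup HypIsom) : Prop :=
  ∃ h : Quotient r ≃ₜ MulAction.orbitRel.Quotient P Disc, ∀ x : M,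
    ∃ (ν : ℚ) (Ψ : Disc × ℝ → M) (σ : Disc → Disc),
      IsFibredSolidTorus I r ν Ψ ∧ x ∈ Set.range Ψ ∧
      IsLocalDiffeomorph 𝓘(ℝ, ℂ) 𝓘(ℝ, ℂ) ∞ σ ∧ Function.Injective σ ∧
      ∀ w : Disc, h (Quotient.mk r (Ψ (w, 0))) = Quotient.mk _ (σ w)

end Seifert

end

/-!
The argument is elementary and uses three facts about the orientation preserving part `DePlus` of
`D_e`, which has index at most two: its elements are the products `T_θ L_g` of a translation along
the fibres and a left translation (`mem_DePlus_or`), the `T_θ` are central in it, and hence the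
commutator of two elements depends only on the isometries of the disc which they cover
(`commutator_normalForm`).

*Discreteness of `p(Γ)`.* Suppose that infinitely many isometries in `p(Γ ∩ DePlus)` fail to move
some compact set off itself. Lifting them to a compact part of the covering group and taking
quotients of successive members of a convergent sequence gives elements `T_{θ n} L_{h n}` of `Γ`
with `h n → 1`, where `h n` acts nontrivially on the disc. For a fixed element `T_η L_k` of `Γ`, the
commutators `⁅h n, k⁆` tend to `1` and belong to `Γ`, so they are eventually trivial by proper
discontinuity at the point `1` (`De.eventually_commute`). Commutation is transitive through elements
acting nontrivially on the disc (`SL2Cover.commute_of_commute`), so `h 0` commutes with all of `Γ ∩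
DePlus`. Its displacement function is then invariant under a cocompact group, hence bounded, and an
orientation preserving isometry of bounded displacement fixes the circle at infinity, so it is the
identity (`Disc.eq_one_of_hypDist_le`). This contradiction shows that `p(Γ)` acts properly
discontinuously on the disc (`De.finite_inter_image_map_p`), and so is discrete.

*Translations in `Γ`.* The kernel of `p` is the group of translations. If `Γ` contained no
nontrivial one, `p` would be injective on `Γ`, and a fibre, which is not compact, would be covered
by finitely many translates of a compact set (`De.exists_trans_mem`).

*The Seifert fibration.* An element of `D_e` reversing a fibre has a fixed point on it, so by
freeness the stabiliser in `Γ` of the fibre over `z` acts on it by a discrete group of translations.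
It is infinite cyclic, generated by a screw motion, and its rotation angle is a rational multiple of
`2π`, since some power is a translation of `Γ` (`De.exists_generator`). A disc around `z` which is
disjoint from its images under the elements of `p(Γ)` not fixing `z` then yields a fibred solid
torus in the quotient, and its cross section is the orbifold chart of the base
(`De.exists_isFibredSolidTorus`).
-/

open scoped commutatorElement

noncomputable section

/-! ### Smooth quotients of manifolds -/

section QuotientManifold

open MulAction

variable {M : Type*} [TopologicalSpace M] {G : Type*} [Group G] [MulAction G M]
  [ContinuousConstSMul G M]

/-- Any two local sections of the projection to the orbit space differ locally by a deck
transformation. -/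
theorem exists_smul_eventuallyEq_localInverseAt
    (hf : IsLocalHomeomorph (Quotient.mk (orbitRel G M)))
    {x y : M} {q : orbitRel.Quotient G M} (hx : q ∈ (hf.localInverseAt x).source)
    (hy : q ∈ (hf.localInverseAt y).source) :
    ∃ γ : G, ∀ᶠ q' in 𝓝 q, hf.localInverseAt y q' = γ • hf.localInverseAt x q' := by
  have h1 : (Quotient.mk _ (hf.localInverseAt y q) : orbitRel.Quotient G M) =
      Quotient.mk _ (hf.localInverseAt x q) := by
    rw [hf.apply_localInverseAt_of_mem hx, hf.apply_localInverseAt_of_mem hy]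
  obtain ⟨γ, hγ⟩ := orbitRel_apply.1 (Quotient.exact h1)
  refine ⟨γ, ?_⟩
  have hc : ContinuousAt (fun q' => γ • hf.localInverseAt x q') q :=
    ((hf.localInverseAt x).continuousAt hx).const_smul γ
  have ht : (hf.localInverseAt y).target ∈ 𝓝 (γ • hf.localInverseAt x q) := by
    refine (hf.localInverseAt y).open_target.mem_nhds ?_
    change γ • hf.localInverseAt x q = _ at hγ
    rw [hγ]
    exact (hf.localInverseAt y).map_source hy
  filter_upwards [hc ht, (hf.localInverseAt x).open_source.mem_nhds hx,
    (hf.localInverseAt y).open_source.mem_nhds hy] with q' h2 h3 h4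
  refine hf.injOn_localInverseAt_target ((hf.localInverseAt y).map_source h4) h2 ?_
  rw [hf.apply_localInverseAt_of_mem h4]
  have : (Quotient.mk _ (γ • hf.localInverseAt x q') : orbitRel.Quotient G M) =
      Quotient.mk _ (hf.localInverseAt x q') := Quotient.sound (mem_orbit _ _)
  exact ((this.trans (hf.apply_localInverseAt_of_mem h3))).symm

variable [ProperlyDiscontinuousSMul G M] [IsCancelSMul G M]
  [T2Space M] [LocallyCompactSpace M]
  {𝕜 : Type*} [NontriviallyNormedField 𝕜] {E : Type*} [NormedAddCommGroup E] [NormedSpace 𝕜 E]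
  {H : Type*} [TopologicalSpace H] [ChartedSpace H M] {I : ModelWithCorners 𝕜 E H} {n : ℕ∞ω}

/-- Every orbit projection of a free properly discontinuous action is a local homeomorphism. -/
theorem isLocalHomeomorph_quotientMk :
    IsLocalHomeomorph (Quotient.mk (orbitRel G M)) :=
  isQuotientCoveringMap_quotientMk_of_properlyDiscontinuousSMul.isCoveringMap.isLocalHomeomorph

theorem exists_eq_localInverseAt_trans_of_mem_atlas
    {e : OpenPartialHomeomorph (orbitRel.Quotient G M) H}
    (he : e ∈ atlas H (orbitRel.Quotient G M)) :
    ∃ x : M, e =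
      ((isLocalHomeomorph_quotientMk (G := G)).localInverseAt x).trans (chartAt H x) := by
  obtain ⟨q, rfl⟩ := he
  exact ⟨_, rfl⟩

/-- The orbit space of a free properly discontinuous action by `C^n` diffeomorphisms is a `C^n`
manifold. -/
theorem isManifold_orbitRelQuotient [IsManifold I n M]
    (hs : ∀ g : G, ContMDiff I I n (fun x : M => g • x)) :
    IsManifold I n (orbitRel.Quotient G M) := by
  apply isManifold_of_contDiffOn
  intro e e' he he'
  have key : ContMDiffOn I I n (e.symm.trans e') (e.symm.trans e').source := by
    obtain ⟨x, rfl⟩ := exists_eq_localInverseAt_trans_of_mem_atlas he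
    obtain ⟨y, rfl⟩ := exists_eq_localInverseAt_trans_of_mem_atlas he'
    set hf : IsLocalHomeomorph (Quotient.mk (orbitRel G M)) := isLocalHomeomorph_quotientMk
    intro u hu
    simp only [OpenPartialHomeomorph.trans_source, OpenPartialHomeomorph.symm_source,
      OpenPartialHomeomorph.trans_symm_eq_symm_trans_symm,
      OpenPartialHomeomorph.coe_trans, Set.mem_inter_iff, Set.mem_preimage,
      Function.comp_apply] at hu
    obtain ⟨⟨hu1, hu2⟩, hu3, hu4⟩ := hu
    set q := (hf.localInverseAt x).symm ((chartAt H x).symm u) with hq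
    have hqx : q ∈ (hf.localInverseAt x).source := (hf.localInverseAt x).map_target hu2
    have hqx' : hf.localInverseAt x q = (chartAt H x).symm u :=
      (hf.localInverseAt x).right_inv hu2
    obtain ⟨γ, hγ⟩ := exists_smul_eventuallyEq_localInverseAt hf hqx hu3
    have hc1 : ContMDiffAt I I n (chartAt H x).symm u :=
      contMDiffAt_symm_of_mem_maximalAtlas (IsManifold.chart_mem_maximalAtlas x) hu1
    have e1 := hγ.self_of_nhds
    have hc2 : ContMDiffAt I I n (chartAt H y) (γ • (chartAt H x).symm u) := by
      refine contMDiffAt_of_mem_maximalAtlas (IsManifold.chart_mem_maximalAtlas y) ?_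
      rw [← hqx', ← e1]; exact hu4
    have hc3 := hc2.comp u (((hs γ).contMDiffAt).comp u hc1)
    have hcont : ContinuousAt (fun u' => (hf.localInverseAt x).symm ((chartAt H x).symm u')) u :=
      ContinuousAt.comp (g := (hf.localInverseAt x).symm)
        ((hf.localInverseAt x).symm.continuousAt hu2) hc1.continuousAt
    refine (hc3.congr_of_eventuallyEq ?_).contMDiffWithinAt
    filter_upwards [hcont.eventually hγ, hc1.continuousAt
      ((hf.localInverseAt x).open_target.mem_nhds hu2)] with u' h1 h2
    change (chartAt H y) (hf.localInverseAt y _) = (chartAt H y) (γ • (chartAt H x).symm u')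
    change hf.localInverseAt y ((hf.localInverseAt x).symm ((chartAt H x).symm u')) = _ at h1
    erw [h1, (hf.localInverseAt x).right_inv h2]
  rcases Set.eq_empty_or_nonempty (e.symm.trans e').source with h0 | ⟨u, hu⟩
  · rw [h0]; simp
  have := (contMDiffOn_iff.1 key).2 u u
  refine this.mono ?_ |>.congr ?_
  · rintro v ⟨hv, hv'⟩
    simpa [hv', chartAt_self_eq] using hv
  · intro v hv
    simp [chartAt_self_eq]

/-- The projection to the orbit space of a free properly discontinuous action by `C^n`
diffeomorphisms is a local diffeomorphism. -/
theorem isLocalDiffeomorph_quotientMk [IsManifold I n M]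
    (hs : ∀ g : G, ContMDiff I I n (fun x : M => g • x)) :
    IsLocalDiffeomorph I I n (fun x : M => (Quotient.mk _ x : orbitRel.Quotient G M)) := by
  have := isManifold_orbitRelQuotient (I := I) (n := n) hs
  set hf : IsLocalHomeomorph (Quotient.mk (orbitRel G M)) := isLocalHomeomorph_quotientMk
  have hchart (q : orbitRel.Quotient G M) : ∃ z : M, q ∈ (hf.localInverseAt z).source ∧
      hf.localInverseAt z q ∈ (chartAt H z).source ∧
      (hf.localInverseAt z).trans (chartAt H z) ∈ atlas H (orbitRel.Quotient G M) := by
    obtain ⟨z, hz⟩ := exists_eq_localInverseAt_trans_of_mem_atlas (chart_mem_atlas H q)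
    have h := mem_chart_source H q
    rw [hz] at h
    exact ⟨z, h.1, h.2, hz ▸ chart_mem_atlas H q⟩
  -- each local section is smooth, as it differs from a chart by a deck transformation
  have hsec (x : M) (q) (hq : q ∈ (hf.localInverseAt x).source) :
      ContMDiffAt I I n (hf.localInverseAt x) q := by
    obtain ⟨z, hz1, hz2, hz3⟩ := hchart q
    obtain ⟨γ, hγ⟩ := exists_smul_eventuallyEq_localInverseAt hf hz1 hq
    have h1 : ContMDiffAt I I n ((hf.localInverseAt z).trans (chartAt H z)) q :=
      contMDiffAt_of_mem_maximalAtlas (IsManifold.subset_maximalAtlas hz3) ⟨hz1, hz2⟩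
    have h2 : ContMDiffAt I I n (chartAt H z).symm
        (((hf.localInverseAt z).trans (chartAt H z)) q) :=
      contMDiffAt_symm_of_mem_maximalAtlas (IsManifold.chart_mem_maximalAtlas z)
        ((chartAt H z).map_source hz2)
    refine ((hs γ).contMDiffAt.comp q (h2.comp q h1)).congr_of_eventuallyEq ?_
    filter_upwards [hγ, ((hf.localInverseAt z).continuousAt hz1)
      ((chartAt H z).open_source.mem_nhds hz2)] with q' h3 h4
    rw [h3]
    exact congrArg (γ • ·) ((chartAt H z).left_inv h4).symm
  have hmk (x : M) : ContMDiffAt I I n (Quotient.mk (orbitRel G M)) x := by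
    obtain ⟨z, hz1, hz2, hz3⟩ := hchart (Quotient.mk _ x)
    have hx := hf.apply_self_mem_localInverseAt_source (x := x)
    obtain ⟨γ, hγ⟩ := exists_smul_eventuallyEq_localInverseAt hf hx hz1
    have e1 := hγ.self_of_nhds
    rw [hf.localInverseAt_apply_self] at e1
    have h1 : ContMDiffAt I I n (chartAt H z) (γ • x) :=
      contMDiffAt_of_mem_maximalAtlas (IsManifold.chart_mem_maximalAtlas z) (e1 ▸ hz2)
    have h2 : ContMDiffAt I I n ((hf.localInverseAt z).trans (chartAt H z)).symm
        (chartAt H z (γ • x)) := by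
      refine contMDiffAt_symm_of_mem_maximalAtlas (IsManifold.subset_maximalAtlas hz3) ?_
      rw [← e1]
      exact ((hf.localInverseAt z).trans (chartAt H z)).map_source ⟨hz1, hz2⟩
    refine (h2.comp x (h1.comp x (hs γ).contMDiffAt)).congr_of_eventuallyEq ?_
    have hcont : ContinuousAt (fun x' : M => γ • x') x := continuous_const_smul γ |>.continuousAt
    have h3 : ∀ᶠ x' in 𝓝 x, γ • x' ∈ (chartAt H z).source :=
      hcont ((chartAt H z).open_source.mem_nhds (by simpa only [← e1] using hz2))
    filter_upwards [h3] with x' h4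
    change _ = (hf.localInverseAt z).symm ((chartAt H z).symm (chartAt H z (γ • x')))
    rw [(chartAt H z).left_inv h4, hf.localInverseAt_symm]
    exact (Quotient.sound (mem_orbit _ _) :
      (Quotient.mk _ (γ • x') : orbitRel.Quotient G M) = Quotient.mk _ x').symm
  intro x
  refine ⟨{ (hf.localInverseAt x).symm with
    contMDiffOn_toFun := ?_
    contMDiffOn_invFun := ?_ }, hf.self_mem_localInverseAt_target, ?_⟩
  · intro y _
    change ContMDiffWithinAt I I n (hf.localInverseAt x).symm _ y
    rw [hf.localInverseAt_symm x]
    exact (hmk y).contMDiffWithinAt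
  · intro q hq
    exact (hsec x q hq).contMDiffWithinAt
  · intro y _
    exact (congrFun (hf.localInverseAt_symm x) y).symm

end QuotientManifold

/-! ### Topology and smooth structure of the universal cover -/

instance : LocallyCompactSpace Disc := Disc.isOpen.locallyCompactSpace

namespace Disc

@[simp] theorem norm_unit (α : ℝ) : ‖unit α‖ = 1 := norm_exp_ofReal_mul_I α

theorem unit_eq_one_iff {α : ℝ} : unit α = 1 ↔ ∃ n : ℤ, α = n * (2 * Real.pi) := by
  rw [unit, exp_eq_one_iff]
  refine exists_congr fun n => ?_
  rw [← ofReal_inj]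
  push_cast
  rw [← mul_assoc, mul_left_inj' I_ne_zero]

@[fun_prop]
theorem continuous_unit : Continuous unit := by unfold unit; fun_prop

theorem continuous_iff_coe {X : Type*} [TopologicalSpace X] {f : X → Disc} :
    Continuous f ↔ Continuous fun x => (f x : ℂ) :=
  continuous_induced_rng

@[fun_prop]
theorem continuous_coe : Continuous fun z : Disc => (z : ℂ) := continuous_subtype_val

theorem continuous_mob : Continuous fun p : ℝ × Disc × Disc => mob p.1 p.2.1 p.2.2 := by
  rw [continuous_iff_coe]
  simp only [coe_mob]
  refine Continuous.div (by fun_prop) ?_ fun p => den_ne_zero _ _ _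
  unfold den
  fun_prop

theorem continuous_arg_den :
    Continuous fun p : ℝ × Disc × Disc => arg (den p.1 p.2.1 p.2.2) := by
  have h : Continuous fun p : ℝ × Disc × Disc => den p.1 p.2.1 p.2.2 := by
    unfold den
    fun_prop
  rw [continuous_iff_continuousAt]
  intro p
  exact ContinuousAt.comp (g := arg)
    (continuousAt_arg (Or.inl (den_re_pos p.1 p.2.1 p.2.2))) h.continuousAt

theorem mob_zero_zero (z : Disc) : mob 0 zero z = z :=
  Subtype.ext (by simp [den, zero])

@[simp] theorem mob_apply_zero (α : ℝ) (a : Disc) : mob α a zero = a :=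
  Subtype.ext (by simp [den, zero])

theorem mob_zero_right (α : ℝ) (z : Disc) : mob α zero z = rot α z :=
  Subtype.ext (by simp [den, zero])

@[simp] theorem rot_zero_apply (α : ℝ) : rot α zero = zero := Subtype.ext (by simp [zero])

@[simp] theorem conjD_conjD (z : Disc) : conjD (conjD z) = z := Subtype.ext (by simp)

theorem contMDiff_iff_coe {E : Type*} [NormedAddCommGroup E] [NormedSpace ℝ E] {H : Type*}
    [TopologicalSpace H] {I : ModelWithCorners ℝ E H} {M : Type*} [TopologicalSpace M]
    [ChartedSpace H M] {f : M → Disc} :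
    ContMDiff I 𝓘(ℝ, ℂ) ∞ f ↔ ContMDiff I 𝓘(ℝ, ℂ) ∞ fun x => (f x : ℂ) :=
  (ContMDiff.subtypeVal_comp_iff Disc f).symm

theorem contMDiff_coe : ContMDiff 𝓘(ℝ, ℂ) 𝓘(ℝ, ℂ) ∞ fun z : Disc => (z : ℂ) :=
  contMDiff_subtype_val

theorem contMDiff_mob (α : ℝ) (a : Disc) : ContMDiff 𝓘(ℝ, ℂ) 𝓘(ℝ, ℂ) ∞ (mob α a) := by
  rw [contMDiff_iff_coe]
  intro z
  have h : ContDiffAt ℝ ∞ (fun w : ℂ =>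
      (unit α * w + a) / (1 + conj (a : ℂ) * unit α * w)) (z : ℂ) := by
    simp only [div_eq_mul_inv]
    exact ContDiffAt.mul (by fun_prop) (ContDiffAt.inv (by fun_prop) (den_ne_zero α a z))
  exact h.comp_contMDiffAt contMDiff_coe.contMDiffAt

theorem contMDiff_conjD : ContMDiff 𝓘(ℝ, ℂ) 𝓘(ℝ, ℂ) ∞ conjD := by
  rw [contMDiff_iff_coe]
  exact (conjCLE : ℂ →L[ℝ] ℂ).contDiff.comp_contMDiff contMDiff_coe

theorem contMDiff_arg_den (α : ℝ) (a : Disc) :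
    ContMDiff 𝓘(ℝ, ℂ) 𝓘(ℝ, ℝ) ∞ fun z => arg (den α a z) := by
  intro z
  have h1 : ContDiffAt ℝ ∞ log (den α a z) :=
    (contDiffAt_log (n := ∞) (Or.inl (den_re_pos α a z))).restrict_scalars ℝ
  have h2 : ContDiffAt ℝ ∞ (fun w : ℂ => 1 + conj (a : ℂ) * unit α * w) z := by fun_prop
  have h3 : ContDiffAt ℝ ∞ (fun w : ℂ => (log (1 + conj (a : ℂ) * unit α * w)).im) z :=
    imCLM.contDiff.contDiffAt.comp (z : ℂ) (ContDiffAt.comp (g := log) (z : ℂ) h1 h2)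
  refine (h3.comp_contMDiffAt (f := fun z : Disc => (z : ℂ))
    contMDiff_coe.contMDiffAt).congr_of_eventuallyEq (Filter.Eventually.of_forall fun w => ?_)
  exact (log_im _).symm

end Disc

namespace SL2Cover

instance : T2Space SL2Cover := inferInstanceAs (T2Space (ℝ × Disc))

instance : LocallyCompactSpace SL2Cover := inferInstanceAs (LocallyCompactSpace (ℝ × Disc))

instance : SecondCountableTopology SL2Cover :=
  inferInstanceAs (SecondCountableTopology (ℝ × Disc))

instance : IsManifold (𝓘(ℝ, ℝ).prod 𝓘(ℝ, ℂ)) ∞ SL2Cover :=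
  inferInstanceAs (IsManifold (𝓘(ℝ, ℝ).prod 𝓘(ℝ, ℂ)) ∞ (ℝ × Disc))

@[fun_prop]
theorem continuous_ang : Continuous ang := continuous_fst

@[fun_prop]
theorem continuous_pt : Continuous pt := continuous_snd

theorem continuous_mk : Continuous fun p : ℝ × Disc => mk p.1 p.2 := continuous_id

theorem contMDiff_ang : ContMDiff (𝓘(ℝ, ℝ).prod 𝓘(ℝ, ℂ)) 𝓘(ℝ, ℝ) ∞ ang :=
  contMDiff_fst (M := ℝ) (N := Disc)

theorem contMDiff_pt : ContMDiff (𝓘(ℝ, ℝ).prod 𝓘(ℝ, ℂ)) 𝓘(ℝ, ℂ) ∞ pt :=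
  contMDiff_snd (M := ℝ) (N := Disc)

theorem _root_.ContMDiff.sl2CoverMk {E : Type*} [NormedAddCommGroup E] [NormedSpace ℝ E]
    {H : Type*} [TopologicalSpace H] {I : ModelWithCorners ℝ E H} {M : Type*} [TopologicalSpace M]
    [ChartedSpace H M] {f : M → ℝ} {g : M → Disc} (hf : ContMDiff I 𝓘(ℝ, ℝ) ∞ f)
    (hg : ContMDiff I 𝓘(ℝ, ℂ) ∞ g) :
    ContMDiff I (𝓘(ℝ, ℝ).prod 𝓘(ℝ, ℂ)) ∞ fun x => mk (f x) (g x) :=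
  hf.prodMk (N' := Disc) hg

instance : IsTopologicalGroup SL2Cover where
  continuous_mul := by
    have h : Continuous fun p : SL2Cover × SL2Cover => (p.1.ang, p.1.pt, p.2.pt) := by fun_prop
    exact continuous_mk.comp (((continuous_ang.comp continuous_fst).add
      (continuous_ang.comp continuous_snd)).sub
      ((Disc.continuous_arg_den.comp h).const_mul 2) |>.prodMk (Disc.continuous_mob.comp h))
  continuous_inv := by
    refine continuous_mk.comp (continuous_ang.neg.prodMk ?_)
    rw [Disc.continuous_iff_coe]
    change Continuous fun x : SL2Cover => Disc.unit (Real.pi - x.ang) * (x.pt : ℂ)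
    fun_prop

theorem contMDiff_mul_left (g : SL2Cover) :
    ContMDiff (𝓘(ℝ, ℝ).prod 𝓘(ℝ, ℂ)) (𝓘(ℝ, ℝ).prod 𝓘(ℝ, ℂ)) ∞ (fun x : SL2Cover => g * x) := by
  refine ContMDiff.sl2CoverMk ?_ ((Disc.contMDiff_mob _ _).comp contMDiff_pt)
  exact (contMDiff_const.add contMDiff_ang).sub
    (contMDiff_const.mul ((Disc.contMDiff_arg_den _ _).comp contMDiff_pt))

theorem contMDiff_transPerm (θ : ℝ) : ContMDiff (𝓘(ℝ, ℝ).prod 𝓘(ℝ, ℂ))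
    (𝓘(ℝ, ℝ).prod 𝓘(ℝ, ℂ)) ∞ (transPerm θ) :=
  (contMDiff_ang.add contMDiff_const).sl2CoverMk contMDiff_pt

theorem contMDiff_conjAut : ContMDiff (𝓘(ℝ, ℝ).prod 𝓘(ℝ, ℂ))
    (𝓘(ℝ, ℝ).prod 𝓘(ℝ, ℂ)) ∞ conjAut :=
  contMDiff_ang.neg.sl2CoverMk (Disc.contMDiff_conjD.comp contMDiff_pt)

/-! ### A normal form for the elements of `D_e` -/

/-- The translations along the fibres commute with the left translations, because the
multiplication depends on the angle of its right factor only through a shift. -/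
theorem transPerm_mul_mulLeft (θ : ℝ) (g : SL2Cover) :
    transPerm θ * Equiv.mulLeft g = Equiv.mulLeft g * transPerm θ := by
  ext1 x
  refine SL2Cover.ext ?_ rfl
  change (g * x).ang + θ = g.ang + (x.ang + θ) - 2 * arg (Disc.den g.ang g.pt x.pt)
  rw [mul_ang]
  ring

theorem transPerm_add (θ η : ℝ) : transPerm (θ + η) = transPerm θ * transPerm η := by
  ext1 x
  refine SL2Cover.ext ?_ rfl
  change x.ang + (θ + η) = x.ang + η + θ
  ring

theorem transPerm_zero : transPerm 0 = 1 := by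
  ext1 x
  exact SL2Cover.ext (add_zero _) rfl

theorem mulLeft_mul (g k : SL2Cover) :
    Equiv.mulLeft (g * k) = Equiv.mulLeft g * Equiv.mulLeft k :=
  Equiv.ext fun x => mul_assoc g k x

/-- In normal form, products are computed componentwise. -/
theorem mul_normalForm (θ η : ℝ) (g k : SL2Cover) :
    transPerm θ * Equiv.mulLeft g * (transPerm η * Equiv.mulLeft k) =
      transPerm (θ + η) * Equiv.mulLeft (g * k) := by
  rw [transPerm_add, mulLeft_mul, mul_assoc, ← mul_assoc (Equiv.mulLeft g),
    ← transPerm_mul_mulLeft]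
  simp only [mul_assoc]

/-- The orientation preserving part of `D_e`: the products of the central translations
`(α, z) ↦ (α + θ, z)` with the left translations. -/
def DePlus : Subgroup (Equiv.Perm SL2Cover) where
  carrier := {f | ∃ (θ : ℝ) (g : SL2Cover), f = transPerm θ * Equiv.mulLeft g}
  mul_mem' := by
    rintro _ _ ⟨θ, g, rfl⟩ ⟨η, k, rfl⟩
    exact ⟨θ + η, g * k, mul_normalForm θ η g k⟩
  one_mem' := ⟨0, 1, by
    rw [transPerm_zero]
    exact Equiv.ext fun x => (one_mul x).symm⟩
  inv_mem' := by
    rintro _ ⟨θ, g, rfl⟩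
    refine ⟨-θ, g⁻¹, ?_⟩
    rw [inv_eq_iff_mul_eq_one]
    ext1 x
    simp only [Equiv.Perm.mul_apply, Equiv.coe_mulLeft]
    refine SL2Cover.ext ?_ ?_
    · change (g * transPerm (-θ) (g⁻¹ * x)).ang + θ = x.ang
      have := congrArg (fun f => (f (g⁻¹ * x)).ang) (transPerm_mul_mulLeft (-θ) g)
      change (g * (g⁻¹ * x)).ang + -θ = (g * transPerm (-θ) (g⁻¹ * x)).ang at this
      rw [← this, mul_inv_cancel_left]
      ring
    · change (g * (g⁻¹ * x)).pt = x.pt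
      rw [mul_inv_cancel_left]

/-- Rotation of the disc is left translation by `(θ, 0)` followed by the inverse translation. -/
theorem rotAut_eq (θ : ℝ) :
    (rotAut θ).toEquiv = transPerm (-θ) * Equiv.mulLeft (mk θ Disc.zero) := by
  ext1 x
  refine SL2Cover.ext ?_ ?_
  · change x.ang = θ + x.ang - 2 * arg (Disc.den θ Disc.zero x.pt) + -θ
    simp [Disc.den, Disc.zero]
  · exact (Disc.mob_zero_right θ x.pt).symm

/-- The reflection `(α, z) ↦ (-α, conj z)` as a permutation. -/
def conjPerm : Equiv.Perm SL2Cover := conjAut.toEquiv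

theorem conjPerm_mul_self : conjPerm * conjPerm = 1 := by
  ext1 x
  exact SL2Cover.ext (neg_neg _) (Disc.conjD_conjD _)

theorem conjPerm_mul_mul_mem {f : Equiv.Perm SL2Cover} (hf : f ∈ DePlus) :
    conjPerm * f * conjPerm ∈ DePlus := by
  obtain ⟨θ, g, rfl⟩ := hf
  refine ⟨-θ, conjAut g, ?_⟩
  ext1 x
  have h : conjAut (g * conjAut x) = conjAut g * x := by
    rw [map_mul]
    exact congrArg (conjAut g * ·) (DFunLike.congr_fun conjPerm_mul_self x)
  refine SL2Cover.ext ?_ ?_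
  · change -((g * conjAut x).ang + θ) = (conjAut g * x).ang + -θ
    rw [← h]
    change _ = -(g * conjAut x).ang + -θ
    ring
  · exact (congrArg SL2Cover.pt h :)

/-- The orientation preserving elements have index at most two in `D_e`. -/
theorem mem_DePlus_or (f : Equiv.Perm SL2Cover) (hf : f ∈ De) :
    f ∈ DePlus ∨ f * conjPerm ∈ DePlus := by
  have hrot (θ : ℝ) : (rotAut θ).toEquiv ∈ DePlus := ⟨_, _, rotAut_eq θ⟩
  have hc (f : Equiv.Perm SL2Cover) : f * conjPerm * conjPerm = f := by
    rw [mul_assoc, conjPerm_mul_self, mul_one]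
  induction hf using Subgroup.closure_induction with
  | mem F hF =>
    rcases hF with (⟨g, rfl⟩ | ⟨i, rfl⟩) | ⟨θ, rfl⟩
    · exact Or.inl ⟨0, g, by rw [transPerm_zero, one_mul]⟩
    · fin_cases i
      · exact Or.inl (hrot Real.pi)
      · refine Or.inr ?_
        change (rotAut Real.pi).toEquiv * conjPerm * conjPerm ∈ DePlus
        rw [hc]
        exact hrot _
      · refine Or.inr ?_
        change conjPerm * conjPerm ∈ DePlus
        rw [conjPerm_mul_self]
        exact one_mem _
    · exact Or.inl (hrot θ)
  | one => exact Or.inl (one_mem _)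
  | mul F G _ _ hF hG =>
    rcases hF with hF | hF <;> rcases hG with hG | hG
    · exact Or.inl (mul_mem hF hG)
    · exact Or.inr (by rw [mul_assoc]; exact mul_mem hF hG)
    · refine Or.inr ?_
      have := mul_mem hF (conjPerm_mul_mul_mem hG)
      rwa [← mul_assoc, ← mul_assoc, hc] at this
    · refine Or.inl ?_
      have := mul_mem hF (conjPerm_mul_mul_mem hG)
      rwa [← mul_assoc, ← mul_assoc, hc, mul_assoc, mul_assoc, conjPerm_mul_self, mul_one] at this
  | inv F _ hF =>
    refine hF.imp inv_mem fun h => ?_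
    have h2 := conjPerm_mul_mul_mem (inv_mem h)
    have h3 : conjPerm⁻¹ = conjPerm := inv_eq_of_mul_eq_one_left conjPerm_mul_self
    rw [mul_inv_rev, h3, ← mul_assoc, conjPerm_mul_self, one_mul] at h2
    exact h2

/-- The elements of `D_e` are diffeomorphisms. -/
theorem contMDiff_of_mem_De {f : Equiv.Perm SL2Cover} (hf : f ∈ De) :
    ContMDiff (𝓘(ℝ, ℝ).prod 𝓘(ℝ, ℂ)) (𝓘(ℝ, ℝ).prod 𝓘(ℝ, ℂ)) ∞ f := by
  have key {f : Equiv.Perm SL2Cover} (hf : f ∈ DePlus) :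
      ContMDiff (𝓘(ℝ, ℝ).prod 𝓘(ℝ, ℂ)) (𝓘(ℝ, ℝ).prod 𝓘(ℝ, ℂ)) ∞ f := by
    obtain ⟨θ, g, rfl⟩ := hf
    exact (contMDiff_transPerm θ).comp (contMDiff_mul_left g)
  rcases mem_DePlus_or f hf with h | h
  · exact key h
  · have := (key h).comp contMDiff_conjAut
    rwa [show ⇑(f * conjPerm) ∘ conjAut = f from
      funext fun x => congrArg f (DFunLike.congr_fun conjPerm_mul_self x)] at this

end SL2Cover

/-! ### Commuting isometries and displacement -/

namespace SL2Cover

/-- Commutation in the universal cover, read off the coefficients of the Möbius transformations. -/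
theorem commute_iff (x y : SL2Cover) : Commute x y ↔
    conj (x.pt : ℂ) * Disc.unit x.ang * y.pt = conj (y.pt : ℂ) * Disc.unit y.ang * x.pt ∧
      (Disc.unit x.ang - 1) * (y.pt : ℂ) = (Disc.unit y.ang - 1) * x.pt := by
  constructor
  · intro h
    have h1 : arg (Disc.den x.ang x.pt y.pt) = arg (Disc.den y.ang y.pt x.pt) := by
      have := congrArg ang h.eq
      rw [mul_ang, mul_ang] at this
      linarith
    have h2 : (Disc.mob x.ang x.pt y.pt : ℂ) = Disc.mob y.ang y.pt x.pt :=
      congrArg (fun z : SL2Cover => (z.pt : ℂ)) h.eq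
    rw [Disc.coe_mob, Disc.coe_mob] at h2
    have hx : 0 < 1 - normSq (x.pt : ℂ) := by linarith [Disc.normSq_lt x.pt]
    have hy : 0 < 1 - normSq (y.pt : ℂ) := by linarith [Disc.normSq_lt y.pt]
    have h3 : normSq (Disc.den x.ang x.pt y.pt) = normSq (Disc.den y.ang y.pt x.pt) := by
      have e1 := Disc.mob_sub x.ang x.pt y.pt
      have e2 := Disc.mob_sub y.ang y.pt x.pt
      rw [h2, e2, mul_comm (1 - normSq (y.pt : ℂ))] at e1
      have p1 : normSq (Disc.den x.ang x.pt y.pt) ≠ 0 := by simpa using Disc.den_ne_zero _ _ _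
      have p2 : normSq (Disc.den y.ang y.pt x.pt) ≠ 0 := by simpa using Disc.den_ne_zero _ _ _
      rw [div_eq_div_iff p2 p1] at e1
      exact mul_left_cancel₀ (mul_pos hx hy).ne' e1
    have h4 : Disc.den x.ang x.pt y.pt = Disc.den y.ang y.pt x.pt := by
      refine ext_norm_arg ?_ h1
      rw [normSq_eq_norm_sq, normSq_eq_norm_sq] at h3
      exact (sq_eq_sq₀ (norm_nonneg _) (norm_nonneg _)).1 h3
    rw [h4, div_left_inj' (Disc.den_ne_zero _ _ _)] at h2
    refine ⟨add_left_cancel h4, by linear_combination h2⟩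
  · rintro ⟨h1, h2⟩
    have h3 : Disc.den x.ang x.pt y.pt = Disc.den y.ang y.pt x.pt := congrArg (1 + ·) h1
    refine SL2Cover.ext ?_ (Subtype.ext ?_)
    · rw [mul_ang, mul_ang, h3]
      ring
    · rw [mul_pt, mul_pt, Disc.coe_mob, Disc.coe_mob, h3]
      congr 1
      linear_combination h2

/-- Commutation is transitive through an element which does not act trivially on the disc. -/
theorem commute_of_commute {x y z : SL2Cover}
    (hx : ¬(Disc.unit x.ang = 1 ∧ x.pt = Disc.zero)) (hy : Commute x y) (hz : Commute x z) :
    Commute y z := by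
  rw [commute_iff] at hy hz ⊢
  obtain ⟨hy1, hy2⟩ := hy
  obtain ⟨hz1, hz2⟩ := hz
  by_cases ha : (x.pt : ℂ) = 0
  · have hu : Disc.unit x.ang - 1 ≠ 0 := fun h =>
      hx ⟨sub_eq_zero.1 h, Subtype.ext ha⟩
    rw [ha, mul_zero, mul_eq_zero, or_iff_right hu] at hy2 hz2
    simp [hy2, hz2]
  · constructor
    · apply mul_left_cancel₀ ha
      linear_combination (y.pt : ℂ) * hz1 - (z.pt : ℂ) * hy1
    · apply mul_left_cancel₀ ha
      linear_combination (y.pt : ℂ) * hz2 - (z.pt : ℂ) * hy2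

end SL2Cover

namespace Disc

theorem continuous_hypDist : Continuous fun p : Disc × Disc => hypDist p.1 p.2 := by
  unfold hypDist
  refine continuous_const.mul (Real.continuous_arsinh.comp (Continuous.div ?_ ?_ ?_))
  · fun_prop
  · exact Real.continuous_sqrt.comp
      ((continuous_const.sub (continuous_normSq.comp (by fun_prop))).mul
        (continuous_const.sub (continuous_normSq.comp (by fun_prop))))
  · intro p
    have h1 := normSq_lt p.1
    have h2 := normSq_lt p.2
    exact (Real.sqrt_pos.2 (mul_pos (by linarith) (by linarith))).ne'

/-- Points at bounded hyperbolic distance become Euclidean close near the boundary circle. -/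
theorem norm_sub_le_of_hypDist_le {z w : Disc} {C : ℝ} (h : hypDist z w ≤ C) :
    ‖(z : ℂ) - w‖ ≤ Real.sinh (C / 2) * √(1 - normSq (z : ℂ)) := by
  have h1 := normSq_lt z
  have h2 := normSq_lt w
  have h3 : 0 < √((1 - normSq (z : ℂ)) * (1 - normSq (w : ℂ))) :=
    Real.sqrt_pos.2 (mul_pos (by linarith) (by linarith))
  have h4 : ‖(z : ℂ) - w‖ / √((1 - normSq (z : ℂ)) * (1 - normSq (w : ℂ))) ≤
      Real.sinh (C / 2) := by
    rw [← Real.arsinh_le_arsinh, Real.arsinh_sinh]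
    unfold hypDist at h
    linarith
  have h5 : 0 ≤ Real.sinh (C / 2) := le_trans (by positivity) h4
  rw [div_le_iff₀ h3] at h4
  refine h4.trans (mul_le_mul_of_nonneg_left (Real.sqrt_le_sqrt ?_) h5)
  nlinarith [normSq_nonneg (w : ℂ)]

/-- An orientation preserving isometry of bounded displacement is the identity, since it fixes all
points of the circle at infinity. -/
theorem eq_one_of_hypDist_le {α : ℝ} {a : Disc} {C : ℝ}
    (h : ∀ z, hypDist z (mob α a z) ≤ C) : unit α = 1 ∧ a = zero := by
  have key (ζ : ℂ) (hζ : ‖ζ‖ = 1) :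
      (1 - unit α) * ζ + conj (a : ℂ) * unit α * ζ ^ 2 - a = 0 := by
    rw [← norm_le_zero_iff]
    have hcl : (1 : ℝ) ∈ closure (Set.Ico 0 1) := by
      rw [closure_Ico zero_ne_one]; exact Set.right_mem_Icc.2 zero_le_one
    have hle := ContinuousWithinAt.closure_le (s := Set.Ico (0 : ℝ) 1) (x := 1)
      (f := fun r : ℝ => ‖(1 - unit α) * (r * ζ) + conj (a : ℂ) * unit α * (r * ζ) ^ 2 - a‖)
      (g := fun r : ℝ => 2 * (Real.sinh (C / 2) * √(1 - r ^ 2))) hcl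
      (by fun_prop) (by fun_prop) ?_
    · simpa using hle
    · rintro r ⟨hr0, hr1⟩
      have hn : normSq (r * ζ) = r ^ 2 := by
        rw [normSq_eq_norm_sq, norm_mul, hζ, norm_real, Real.norm_of_nonneg hr0, mul_one]
      set z : Disc := mk (r * ζ) (by rw [hn]; nlinarith) with hz
      have hzc : (z : ℂ) = r * ζ := rfl
      have h1 := norm_sub_le_of_hypDist_le (h z)
      have h2 : (1 - unit α) * (r * ζ) + conj (a : ℂ) * unit α * (r * ζ) ^ 2 - a =
          den α a z * (z - mob α a z) := by
        have := den_ne_zero α a z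
        rw [coe_mob, mul_sub, mul_div_cancel₀ _ this, den, hzc]
        ring
      have h3 : ‖den α a z‖ ≤ 2 := by
        refine (norm_add_le _ _).trans ?_
        rw [norm_one, norm_mul, norm_mul, norm_conj, norm_unit]
        nlinarith [norm_lt a, norm_lt z, norm_nonneg (a : ℂ), norm_nonneg (z : ℂ)]
      rw [h2, norm_mul]
      rw [hzc, hn, ← hzc] at h1
      exact mul_le_mul h3 h1 (norm_nonneg _) zero_le_two
  -- a quadratic polynomial vanishing at `1`, `-1` and `I` is zero
  have h1 := key 1 (by simp)
  have h2 := key (-1) (by simp)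
  have h3 := key I (by simp)
  have e1 : unit α = 1 := by linear_combination (h2 - h1) / 2
  rw [e1] at h1 h2 h3
  refine ⟨e1, Subtype.ext ?_⟩
  change (a : ℂ) = 0
  linear_combination -(h1 + h2) / 4 - h3 / 2 + conj (a : ℂ) / 2 * I_sq

theorem isCompact_normSq_le {c : ℝ} (hc : c < 1) : IsCompact {z : Disc | normSq (z : ℂ) ≤ c} := by
  rw [Subtype.isCompact_iff]
  have : Subtype.val '' {z : Disc | normSq (z : ℂ) ≤ c} = {z : ℂ | normSq z ≤ c} := by
    ext z
    constructor
    · rintro ⟨w, hw, rfl⟩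
      exact hw
    · exact fun hz => ⟨mk z (lt_of_le_of_lt hz hc), hz, rfl⟩
  rw [this]
  refine (isCompact_closedBall (0 : ℂ) 1).of_isClosed_subset
    (isClosed_le continuous_normSq continuous_const) fun z hz => ?_
  have hz' : normSq z ≤ c := hz
  rw [normSq_eq_norm_sq] at hz'
  rw [mem_closedBall_zero_iff]
  nlinarith [norm_nonneg z]

/-- The orientation preserving isometries `mob α a` which do not move a compact set off itself have
their translation parts `a` in a compact set. -/
theorem exists_isCompact_of_mob_mem {K : Set Disc} (hK : IsCompact K) :
    ∃ K' : Set Disc, IsCompact K' ∧ ∀ α a, ∀ z ∈ K, mob α a z ∈ K → a ∈ K' := by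
  rcases K.eq_empty_or_nonempty with rfl | hne
  · exact ⟨∅, isCompact_empty, fun _ _ _ h => h.elim⟩
  obtain ⟨m, -, hm⟩ := hK.exists_isMaxOn hne
    (f := fun z : Disc => ‖(z : ℂ)‖) (by fun_prop)
  set ρ := ‖(m : ℂ)‖ with hρ
  have hρ1 : ρ < 1 := norm_lt m
  have hρ0 : 0 ≤ ρ := norm_nonneg _
  have hpos : 0 < (1 - ρ ^ 2) * (1 - ρ) ^ 2 := mul_pos (by nlinarith) (pow_pos (by linarith) 2)
  refine ⟨_, isCompact_normSq_le (c := 1 - (1 - ρ ^ 2) * (1 - ρ) ^ 2) (by linarith), ?_⟩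
  intro α a z hz hfz
  have h1 : ‖(z : ℂ)‖ ≤ ρ := hm hz
  have h2 : ‖(mob α a z : ℂ)‖ ≤ ρ := hm hfz
  have h3 := mob_sub α a z
  rw [← coe_mob, eq_div_iff (by simpa using den_ne_zero α a z), normSq_eq_norm_sq,
    normSq_eq_norm_sq (den α a z), normSq_eq_norm_sq (z : ℂ)] at h3
  have h4 : 1 - ρ ≤ ‖den α a z‖ := by
    have h5 : ‖conj (a : ℂ) * unit α * z‖ ≤ ρ := by
      rw [norm_mul, norm_mul, norm_conj, norm_unit]
      nlinarith [norm_lt a, norm_nonneg (a : ℂ), norm_nonneg (z : ℂ)]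
    have h6 := norm_sub_norm_le (1 : ℂ) (-(conj (a : ℂ) * unit α * z))
    rw [norm_neg, norm_one, sub_neg_eq_add] at h6
    change _ ≤ ‖den α a z‖ at h6
    linarith
  have ha := normSq_lt a
  change normSq (a : ℂ) ≤ _
  have h7 : (1 - ρ ^ 2) * (1 - ρ) ^ 2 ≤ (1 - ‖(mob α a z : ℂ)‖ ^ 2) * ‖den α a z‖ ^ 2 := by
    apply mul_le_mul
    · nlinarith [norm_nonneg (mob α a z : ℂ)]
    · exact pow_le_pow_left₀ (by linarith) h4 2
    · positivity
    · nlinarith [norm_nonneg (mob α a z : ℂ), norm_lt (mob α a z)]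
  rw [h3] at h7
  nlinarith [sq_nonneg ‖(z : ℂ)‖]

end Disc

/-! ### Discreteness of the group of isometries -/

namespace SL2Cover

theorem p_apply_of_eq {ψ : De} {θ : ℝ} {g : SL2Cover}
    (h : (ψ : Equiv.Perm SL2Cover) = transPerm θ * Equiv.mulLeft g) (z : Disc) :
    (De.p ψ : Equiv.Perm Disc) z = Disc.mob g.ang g.pt z := by
  change ((ψ : Equiv.Perm SL2Cover) (mk 0 z)).pt = _
  rw [h]
  rfl

/-- The product of two orientation reversing elements preserves the orientation. -/
theorem mul_mem_DePlus {f g : De} (hf : (f : Equiv.Perm SL2Cover) ∉ DePlus)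
    (hg : (g : Equiv.Perm SL2Cover) ∉ DePlus) : ((f * g : De) : Equiv.Perm SL2Cover) ∈ DePlus := by
  have h := mul_mem ((mem_DePlus_or f f.2).resolve_left hf)
    (conjPerm_mul_mul_mem ((mem_DePlus_or g g.2).resolve_left hg))
  have e : (f : Equiv.Perm SL2Cover) * conjPerm * (conjPerm * (g * conjPerm) * conjPerm) =
      f * g := by
    calc _ = (f : Equiv.Perm SL2Cover) * (conjPerm * conjPerm) * g * (conjPerm * conjPerm) := by
          simp only [mul_assoc]
      _ = f * g := by rw [conjPerm_mul_self, mul_one, mul_one]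
  rwa [e] at h

/-- The normal form can be chosen with `g` in a fundamental domain for the kernel `2πℤ` of the
action on the disc, as left translation by `(2πn, 0)` is a translation along the fibres. -/
theorem exists_normalForm {f : Equiv.Perm SL2Cover} (hf : f ∈ DePlus) :
    ∃ (θ : ℝ) (g : SL2Cover), f = transPerm θ * Equiv.mulLeft g ∧
      g.ang ∈ Set.Icc 0 (2 * Real.pi) := by
  obtain ⟨θ, g, rfl⟩ := hf
  have hp : 0 < 2 * Real.pi := by positivity
  set n := toIcoDiv hp 0 g.ang with hn
  have hm : toIcoMod hp 0 g.ang = g.ang - n * (2 * Real.pi) := by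
    rw [toIcoMod, zsmul_eq_mul]
  have hu : Disc.unit (g.ang - n * (2 * Real.pi)) = Disc.unit g.ang := by
    have : Disc.unit (-(n * (2 * Real.pi))) = 1 :=
      Disc.unit_eq_one_iff.2 ⟨-n, by push_cast; ring⟩
    rw [sub_eq_add_neg, Disc.unit_add, this, mul_one]
  refine ⟨θ + n * (2 * Real.pi), mk (g.ang - n * (2 * Real.pi)) g.pt, ?_, ?_⟩
  · ext1 x
    refine SL2Cover.ext ?_ (Subtype.ext ?_)
    · change g.ang + x.ang - 2 * arg (Disc.den g.ang g.pt x.pt) + θ =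
        g.ang - n * (2 * Real.pi) + x.ang -
          2 * arg (Disc.den (g.ang - n * (2 * Real.pi)) g.pt x.pt) + (θ + n * (2 * Real.pi))
      rw [Disc.den, Disc.den, hu]
      ring
    · change (Disc.unit g.ang * x.pt + g.pt) / Disc.den g.ang g.pt x.pt =
        (Disc.unit (g.ang - n * (2 * Real.pi)) * x.pt + g.pt) /
          Disc.den (g.ang - n * (2 * Real.pi)) g.pt x.pt
      rw [Disc.den, Disc.den, hu]
  · have := toIcoMod_mem_Ico hp 0 g.ang
    rw [hm, zero_add] at this
    exact ⟨this.1, this.2.le⟩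

/-- As translations are central in the orientation preserving part of `D_e`, a commutator is a left
translation, which depends only on the underlying isometries. -/
theorem commutator_normalForm (θ η : ℝ) (g k : SL2Cover) :
    ⁅transPerm θ * Equiv.mulLeft g, transPerm η * Equiv.mulLeft k⁆ = Equiv.mulLeft ⁅g, k⁆ := by
  rw [commutatorElement_def, mul_inv_eq_iff_eq_mul, mul_inv_eq_iff_eq_mul, mul_normalForm,
    ← one_mul (Equiv.mulLeft ⁅g, k⁆), ← transPerm_zero, mul_normalForm, mul_normalForm,
    commutatorElement_def]
  congr 2
  · ring
  · group

end SL2Cover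

open SL2Cover

namespace De

instance (Γ : Subgroup De) : ContinuousConstSMul Γ SL2Cover where
  continuous_const_smul γ := (contMDiff_of_mem_De (γ : De).2).continuous

theorem pt_smul (ψ : De) (x : SL2Cover) : (ψ • x).pt = (p ψ : Equiv.Perm Disc) x.pt :=
  pt_apply ψ x

theorem continuous_p (ψ : De) : Continuous (p ψ : Equiv.Perm Disc) := by
  have h : Continuous fun z : Disc => mk 0 z :=
    continuous_mk.comp (continuous_const.prodMk continuous_id)
  exact continuous_pt.comp ((contMDiff_of_mem_De ψ.2).continuous.comp h)

/-- If `h n → 1` lift the isometries of elements of `Γ`, the commutators of `h n` with a fixed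
element of `Γ` are eventually trivial. -/
theorem eventually_commute {Γ : Subgroup De} [ProperlyDiscontinuousSMul Γ SL2Cover]
    {h : ℕ → SL2Cover} {θ : ℕ → ℝ} (hh : Filter.Tendsto h Filter.atTop (𝓝 1))
    {γ : ℕ → De} (hγ : ∀ n, γ n ∈ Γ)
    (hγh : ∀ n, (γ n : Equiv.Perm SL2Cover) = transPerm (θ n) * Equiv.mulLeft (h n))
    {δ : De} (hδ : δ ∈ Γ) {η : ℝ} {k : SL2Cover}
    (hδk : (δ : Equiv.Perm SL2Cover) = transPerm η * Equiv.mulLeft k) :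
    ∀ᶠ n in Filter.atTop, Commute (h n) k := by
  obtain ⟨U, hU, hU'⟩ :=
    ProperlyDiscontinuousSMul.exists_nhds_image_smul_eq_self Γ (1 : SL2Cover)
  have hlim : Filter.Tendsto (fun n => ⁅h n, k⁆) Filter.atTop (𝓝 1) := by
    have : Continuous fun x : SL2Cover => ⁅x, k⁆ := by
      simp only [commutatorElement_def]
      fun_prop
    have h1 := this.tendsto 1
    rw [commutatorElement_one_left] at h1
    exact h1.comp hh
  filter_upwards [hlim hU] with n hn
  have hc : (⁅γ n, δ⁆ : De) ∈ Γ := by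
    rw [commutatorElement_def]
    exact mul_mem (mul_mem (mul_mem (hγ n) hδ) (inv_mem (hγ n))) (inv_mem hδ)
  have hc1 : (⟨⁅γ n, δ⁆, hc⟩ : Γ) • (1 : SL2Cover) = ⁅h n, k⁆ := by
    have : ((⁅γ n, δ⁆ : De) : Equiv.Perm SL2Cover) = Equiv.mulLeft ⁅h n, k⁆ := by
      rw [← commutator_normalForm (θ n) η, ← hγh, ← hδk]
      rfl
    change ((⁅γ n, δ⁆ : De) : Equiv.Perm SL2Cover) 1 = _
    rw [this]
    exact mul_one _
  have h1 := hU' ⟨⁅γ n, δ⁆, hc⟩ ⟨_, ⟨1, mem_of_mem_nhds hU, rfl⟩, by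
    change (⟨⁅γ n, δ⁆, hc⟩ : Γ) • (1 : SL2Cover) ∈ U
    rw [hc1]
    exact hn⟩
  rw [hc1] at h1
  exact commutatorElement_eq_one_iff_commute.1 h1

/-- If `p(Γ)` acts cocompactly on the disc, so does the image of its orientation preserving part,
which has index at most two. -/
theorem exists_isCompact_of_mem_DePlus {Γ : Subgroup De} {K : Set Disc} (hK : IsCompact K)
    (hKΓ : ∀ z, ∃ γ ∈ Γ, (p γ : Equiv.Perm Disc) z ∈ K) :
    ∃ K' : Set Disc, IsCompact K' ∧ ∀ z, ∃ γ ∈ Γ, (γ : Equiv.Perm SL2Cover) ∈ DePlus ∧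
      (p γ : Equiv.Perm Disc) z ∈ K' := by
  by_cases hτ : ∃ τ ∈ Γ, (τ : Equiv.Perm SL2Cover) ∉ DePlus
  · obtain ⟨τ, hτΓ, hτ⟩ := hτ
    refine ⟨K ∪ (p τ : Equiv.Perm Disc) '' K, hK.union (hK.image (continuous_p τ)), fun z => ?_⟩
    obtain ⟨γ, hγ, hz⟩ := hKΓ z
    by_cases h : (γ : Equiv.Perm SL2Cover) ∈ DePlus
    · exact ⟨γ, hγ, h, Or.inl hz⟩
    · refine ⟨τ * γ, mul_mem hτΓ hγ, mul_mem_DePlus hτ h, Or.inr ⟨_, hz, ?_⟩⟩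
      rw [map_mul]
      rfl
  · push Not at hτ
    refine ⟨K, hK, fun z => ?_⟩
    obtain ⟨γ, hγ, hz⟩ := hKΓ z
    exact ⟨γ, hγ, hτ γ hγ, hz⟩

/-- The orientation preserving part of `p(Γ)` acts properly discontinuously on the disc. -/
theorem finite_inter_image_of_mem_DePlus {Γ : Subgroup De} [ProperlyDiscontinuousSMul Γ SL2Cover]
    {K₀ : Set Disc} (hK₀ : IsCompact K₀)
    (hKΓ : ∀ z, ∃ γ ∈ Γ, (p γ : Equiv.Perm Disc) z ∈ K₀) {K : Set Disc} (hK : IsCompact K) :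
    {f : HypIsom | ∃ γ ∈ Γ, (γ : Equiv.Perm SL2Cover) ∈ DePlus ∧ p γ = f ∧
      ((f : Equiv.Perm Disc) '' K ∩ K).Nonempty}.Finite := by
  by_contra hinf
  obtain ⟨K', hK', hKK'⟩ := Disc.exists_isCompact_of_mob_mem hK
  obtain ⟨K₁, hK₁, hK₁Γ⟩ := exists_isCompact_of_mem_DePlus hK₀ hKΓ
  let f := Set.Infinite.natEmbedding _ hinf
  let S : Set SL2Cover := (Set.Icc 0 (2 * Real.pi) ×ˢ K' : Set (ℝ × Disc))
  have hS : IsCompact S := isCompact_Icc.prod hK'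
  have hf (n : ℕ) : ∃ γ ∈ Γ, ∃ (θ : ℝ) (g : SL2Cover),
      (γ : Equiv.Perm SL2Cover) = transPerm θ * Equiv.mulLeft g ∧ p γ = f n ∧
      g ∈ S := by
    obtain ⟨γ, hγ, hγ', hγf, w, ⟨z, hz, rfl⟩, hw⟩ := (f n).2
    obtain ⟨θ, g, hg, hga⟩ := exists_normalForm hγ'
    refine ⟨γ, hγ, θ, g, hg, hγf, hga, hKK' g.ang g.pt z hz ?_⟩
    rw [← p_apply_of_eq hg, hγf]
    exact hw
  choose γ hγ θ g hg hγf hgK using hf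
  obtain ⟨g₀, -, φ, hφ, hlim⟩ := hS.tendsto_subseq hgK
  -- the successive quotients of a convergent sequence of lifts tend to the identity
  set h : ℕ → SL2Cover := fun n => (g (φ n))⁻¹ * g (φ (n + 1)) with hh
  have hh1 : Filter.Tendsto h Filter.atTop (𝓝 1) := by
    have h2 : Filter.Tendsto (fun n => g (φ (n + 1))) Filter.atTop (𝓝 g₀) :=
      hlim.comp (Filter.tendsto_add_atTop_nat 1)
    have := hlim.inv.mul h2
    rwa [inv_mul_cancel] at this
  have hquot (n : ℕ) : (((γ (φ n))⁻¹ * γ (φ (n + 1)) : De) : Equiv.Perm SL2Cover) =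
      transPerm (θ (φ (n + 1)) - θ (φ n)) * Equiv.mulLeft (h n) := by
    rw [Subgroup.coe_mul, Subgroup.coe_inv, inv_mul_eq_iff_eq_mul, hg, hg, mul_normalForm,
      hh, mul_inv_cancel_left]
    congr 2
    ring
  have hne (n : ℕ) : ¬(Disc.unit (h n).ang = 1 ∧ (h n).pt = Disc.zero) := by
    rintro ⟨h1, h2⟩
    have h3 : p ((γ (φ n))⁻¹ * γ (φ (n + 1))) = 1 := by
      refine Subtype.ext (Equiv.ext fun z => ?_)
      rw [p_apply_of_eq (hquot n), h2, Disc.mob_zero_right]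
      exact Subtype.ext (by simp [h1])
    rw [map_mul, map_inv, inv_mul_eq_one, hγf, hγf] at h3
    have := hφ.injective (f.injective (Subtype.ext h3))
    omega
  have hcomm {δ : De} (hδ : δ ∈ Γ) {η : ℝ} {k : SL2Cover}
      (hδk : (δ : Equiv.Perm SL2Cover) = transPerm η * Equiv.mulLeft k) :
      ∀ᶠ n in Filter.atTop, Commute (h n) k :=
    eventually_commute hh1 (fun n => mul_mem (inv_mem (hγ _)) (hγ _)) hquot hδ hδk
  have hcomm0 {δ : De} (hδ : δ ∈ Γ) {η : ℝ} {k : SL2Cover}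
      (hδk : (δ : Equiv.Perm SL2Cover) = transPerm η * Equiv.mulLeft k) : Commute (h 0) k := by
    -- `h n` commutes, for large `n`, with both `k` and `h 0`
    obtain ⟨n, hn1, hn2⟩ := ((hcomm hδ hδk).and
      (hcomm (mul_mem (inv_mem (hγ _)) (hγ _)) (hquot 0))).exists
    exact commute_of_commute (hne n) hn2 hn1
  -- the displacement function of `h 0` is invariant under a cocompact group
  have hcont : Continuous fun z => Disc.hypDist z (Disc.mob (h 0).ang (h 0).pt z) := by
    refine Disc.continuous_hypDist.comp (continuous_id.prodMk ?_)
    exact (Disc.contMDiff_mob _ _).continuous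
  obtain ⟨C, hC⟩ := (hK₁.image hcont).bddAbove
  refine hne 0 (Disc.eq_one_of_hypDist_le (C := C) fun z => ?_)
  obtain ⟨δ, hδ, ⟨η, k, hδk⟩, hz⟩ := hK₁Γ z
  rw [p_apply_of_eq hδk] at hz
  have h1 := hC ⟨_, hz, rfl⟩
  have h2 : Disc.mob (h 0).ang (h 0).pt (Disc.mob k.ang k.pt z) =
      Disc.mob k.ang k.pt (Disc.mob (h 0).ang (h 0).pt z) := by
    rw [← mob_mul, ← mob_mul, (hcomm0 hδ hδk).eq]
  simp only [h2, Disc.hypDist_mob] at h1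
  exact h1

/-- `p(Γ)` acts properly discontinuously on the disc. -/
theorem finite_inter_image_map_p {Γ : Subgroup De} [ProperlyDiscontinuousSMul Γ SL2Cover]
    {K₀ : Set Disc} (hK₀ : IsCompact K₀)
    (hKΓ : ∀ z, ∃ γ ∈ Γ, (p γ : Equiv.Perm Disc) z ∈ K₀) {K : Set Disc} (hK : IsCompact K) :
    {f : HypIsom | f ∈ Γ.map p ∧ ((f : Equiv.Perm Disc) '' K ∩ K).Nonempty}.Finite := by
  by_cases hτ : ∃ τ ∈ Γ, (τ : Equiv.Perm SL2Cover) ∉ DePlus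
  · obtain ⟨τ, hτΓ, hτ⟩ := hτ
    have h1 := finite_inter_image_of_mem_DePlus hK₀ hKΓ hK
    have h2 := (finite_inter_image_of_mem_DePlus hK₀ hKΓ
      (hK.union (hK.image (continuous_p τ⁻¹)))).image (· * (p τ)⁻¹)
    refine (h1.union h2).subset ?_
    rintro _ ⟨⟨γ, hγ, rfl⟩, hne⟩
    by_cases h : (γ : Equiv.Perm SL2Cover) ∈ DePlus
    · exact Or.inl ⟨γ, hγ, h, rfl, hne⟩
    · refine Or.inr ⟨p (γ * τ), ⟨γ * τ, mul_mem hγ hτΓ, mul_mem_DePlus h hτ, rfl, ?_⟩, ?_⟩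
      · obtain ⟨_, ⟨z, hz, rfl⟩, hw⟩ := hne
        refine ⟨(p γ : Equiv.Perm Disc) z,
          ⟨(p τ⁻¹ : Equiv.Perm Disc) z, Or.inr ⟨z, hz, rfl⟩, ?_⟩, Or.inl hw⟩
        have : p (γ * τ) * p τ⁻¹ = p γ := by rw [← map_mul, mul_inv_cancel_right]
        exact congrArg (fun f : HypIsom => (f : Equiv.Perm Disc) z) this
      · change p (γ * τ) * (p τ)⁻¹ = p γ
        rw [map_mul, mul_inv_cancel_right]
  · push Not at hτ
    refine (finite_inter_image_of_mem_DePlus hK₀ hKΓ hK).subset ?_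
    rintro _ ⟨⟨γ, hγ, rfl⟩, hne⟩
    exact ⟨γ, hγ, hτ γ hγ, rfl, hne⟩

end De

instance : T2Space HypIsom :=
  T2Space.of_injective_continuous (f := fun (f : HypIsom) z => (f : Equiv.Perm Disc) z)
    (fun _ _ h => Subtype.ext (Equiv.ext (congrFun h))) continuous_induced_dom

theorem continuous_hypIsom_apply (z : Disc) :
    Continuous fun f : HypIsom => (f : Equiv.Perm Disc) z :=
  (continuous_apply z).comp
    (continuous_induced_dom (f := fun (f : HypIsom) z => (f : Equiv.Perm Disc) z))

/-- A group of isometries of the hyperbolic plane acting properly discontinuously is discrete. -/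
theorem discreteTopology_of_finite {P : Subgroup HypIsom}
    (hP : ∀ K : Set Disc, IsCompact K →
      {f : HypIsom | f ∈ P ∧ ((f : Equiv.Perm Disc) '' K ∩ K).Nonempty}.Finite) :
    DiscreteTopology P := by
  rw [discreteTopology_iff_isOpen_singleton]
  intro f
  obtain ⟨N, hN, hfN⟩ := exists_compact_mem_nhds (((f : HypIsom) : Equiv.Perm Disc) Disc.zero)
  have hcont : Continuous fun g : P => ((g : HypIsom) : Equiv.Perm Disc) Disc.zero :=
    (continuous_hypIsom_apply Disc.zero).comp continuous_subtype_val
  refine isOpen_singleton_of_finite_mem_nhds f (hcont.continuousAt hfN) ?_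
  refine Set.Finite.of_finite_image (f := Subtype.val) ((hP _ (hN.insert Disc.zero)).subset ?_)
    Subtype.val_injective.injOn
  rintro _ ⟨g, hg, rfl⟩
  exact ⟨g.2, _, ⟨_, Set.mem_insert _ _, rfl⟩, Set.mem_insert_of_mem _ hg⟩

/-! ### Translations along the fibres -/

/-- A cocompact action on a locally compact space has a compact set meeting every orbit. -/
theorem exists_isCompact_smul_mem (G X : Type*) [Group G] [TopologicalSpace X]
    [LocallyCompactSpace X] [MulAction G X] [ContinuousConstSMul G X]
    [CompactSpace (MulAction.orbitRel.Quotient G X)] :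
    ∃ C : Set X, IsCompact C ∧ ∀ x : X, ∃ g : G, g • x ∈ C := by
  choose K hK hKx using fun x : X => exists_compact_mem_nhds x
  have hq : IsOpenQuotientMap (Quotient.mk (MulAction.orbitRel G X)) :=
    MulAction.isOpenQuotientMap_quotientMk
  obtain ⟨t, -, ht⟩ := isCompact_univ.elim_nhds_subcover
    (fun q : MulAction.orbitRel.Quotient G X => Quotient.mk _ '' K q.out) (fun q _ => by
      have := hq.isOpenMap.image_mem_nhds (hKx q.out)
      rwa [Quotient.out_eq] at this)
  refine ⟨⋃ q ∈ t, K q.out, t.isCompact_biUnion fun q _ => hK _, fun x => ?_⟩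
  have hx := ht (Set.mem_univ (Quotient.mk _ x))
  simp only [Set.mem_iUnion] at hx
  obtain ⟨q, hq, y, hy, hyx⟩ := hx
  obtain ⟨g, hg⟩ := MulAction.orbitRel_apply.1 (Quotient.exact hyx)
  refine ⟨g, Set.mem_biUnion hq ?_⟩
  change g • x = y at hg
  rwa [hg]

namespace SL2Cover

/-- Orientation preserving elements act on fibres by translations. -/
theorem ang_apply_of_mem {f : Equiv.Perm SL2Cover} (hf : f ∈ DePlus) (x : SL2Cover) :
    (f x).ang = x.ang + (f (mk 0 x.pt)).ang := by
  obtain ⟨θ, g, rfl⟩ := hf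
  change g.ang + x.ang - 2 * arg (Disc.den g.ang g.pt x.pt) + θ =
    x.ang + (g.ang + 0 - 2 * arg (Disc.den g.ang g.pt x.pt) + θ)
  ring

/-- The remaining elements act on fibres by reflections. -/
theorem ang_apply_of_notMem {f : De} (hf : (f : Equiv.Perm SL2Cover) ∉ DePlus) (x : SL2Cover) :
    ((f : Equiv.Perm SL2Cover) x).ang =
      -x.ang + ((f : Equiv.Perm SL2Cover) (mk 0 x.pt)).ang := by
  have h := (mem_DePlus_or f f.2).resolve_left hf
  have h1 := ang_apply_of_mem h (conjPerm x)
  have h2 (y : SL2Cover) : ((f : Equiv.Perm SL2Cover) * conjPerm) (conjPerm y) =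
      (f : Equiv.Perm SL2Cover) y := congrArg (f : Equiv.Perm SL2Cover)
    (DFunLike.congr_fun conjPerm_mul_self y)
  have h3 : mk 0 (conjPerm x).pt = conjPerm (mk 0 x.pt) :=
    SL2Cover.ext neg_zero.symm rfl
  rwa [h3, h2, h2] at h1

end SL2Cover

open SL2Cover

namespace De

@[simp] theorem trans_apply (θ : ℝ) (x : SL2Cover) :
    ((trans (Multiplicative.ofAdd θ) : De) : Equiv.Perm SL2Cover) x = mk (x.ang + θ) x.pt := rfl

/-- The kernel of `p` consists of translations. -/
theorem exists_eq_trans {ψ : De} (h : p ψ = 1) : ∃ θ : Multiplicative ℝ, ψ = trans θ := by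
  have hpt (x : SL2Cover) : ((ψ : Equiv.Perm SL2Cover) x).pt = x.pt := by
    rw [pt_apply]
    exact congrArg (fun f : HypIsom => (f : Equiv.Perm Disc) x.pt) h
  by_cases hψ : (ψ : Equiv.Perm SL2Cover) ∈ DePlus
  · obtain ⟨θ, g, hg⟩ := hψ
    have hg0 : g.pt = Disc.zero := by
      have := hpt (mk 0 Disc.zero)
      rw [hg] at this
      exact (Disc.mob_apply_zero g.ang g.pt).symm.trans this
    refine ⟨Multiplicative.ofAdd (g.ang + θ), Subtype.ext (Equiv.ext fun x => ?_)⟩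
    refine SL2Cover.ext ?_ (hpt x)
    rw [hg]
    change g.ang + x.ang - 2 * arg (Disc.den g.ang g.pt x.pt) + θ = x.ang + (g.ang + θ)
    rw [hg0]
    simp only [Disc.den, Disc.zero, Disc.coe_mk, map_zero, zero_mul, add_zero, arg_one, mul_zero]
    ring
  · obtain ⟨θ, g, hg⟩ := (mem_DePlus_or ψ ψ.2).resolve_left hψ
    have hm (z : Disc) : Disc.mob g.ang g.pt (Disc.conjD z) = z := by
      have h1 : ((ψ : Equiv.Perm SL2Cover) * conjPerm) (mk 0 (Disc.conjD z)) =
          (ψ : Equiv.Perm SL2Cover) (mk (-0) (Disc.conjD (Disc.conjD z))) := rfl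
      have h2 := congrArg pt h1
      rw [hpt, hg] at h2
      exact h2.trans (Disc.conjD_conjD z)
    have hg0 : g.pt = Disc.zero := by
      have := hm Disc.zero
      rwa [show Disc.conjD Disc.zero = Disc.zero from Subtype.ext (by simp [Disc.zero]),
        Disc.mob_apply_zero] at this
    rw [hg0] at hm
    simp only [Disc.mob_zero_right] at hm
    have h1 := congrArg (fun z : Disc => (z : ℂ)) (hm (Disc.mk (1 / 2) (by norm_num [normSq])))
    have h2 := congrArg (fun z : Disc => (z : ℂ)) (hm (Disc.mk (I / 2) (by norm_num [normSq])))
    simp only [Disc.coe_rot, Disc.coe_conjD, Disc.coe_mk, map_div₀, map_one, map_ofNat,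
      conj_I] at h1 h2
    have h3 : Disc.unit g.ang = 1 := by linear_combination 2 * h1
    rw [h3] at h2
    have : I = 0 := by linear_combination -h2
    exact absurd this I_ne_zero

section Free

variable {Γ : Subgroup De}

/-- A free action has no element reversing a fibre, so an element fixing a point of the base
translates the fibre over it. -/
theorem mem_DePlus_of_fix (hfree : ∀ γ : Γ, ∀ x : SL2Cover, γ • x = x → γ = 1) {γ : De} (hγ : γ ∈ Γ)
    {z : Disc} (hz : (p γ : Equiv.Perm Disc) z = z) :
    (γ : Equiv.Perm SL2Cover) ∈ DePlus := by
  by_contra h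
  set c := ((γ : Equiv.Perm SL2Cover) (mk 0 z)).ang with hc
  -- the reflection `α ↦ c - α` of the fibre fixes `c / 2`
  have h1 : (⟨γ, hγ⟩ : Γ) • mk (c / 2) z = mk (c / 2) z := by
    refine SL2Cover.ext ?_ ((pt_apply γ _).trans hz)
    have := ang_apply_of_notMem h (mk (c / 2) z)
    rw [ang_mk, pt_mk, ← hc] at this
    rw [ang_mk]
    exact this.trans (by ring)
  have h2 := congrArg Subtype.val (hfree _ _ h1)
  change γ = 1 at h2
  rw [h2] at h
  exact h (one_mem _)

/-- An element of `Γ` mapping one point of a fibre into the fibre translates the whole fibre. -/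
theorem apply_mk_of_apply_mk (hfree : ∀ γ : Γ, ∀ x : SL2Cover, γ • x = x → γ = 1) {γ : De}
    (hγ : γ ∈ Γ) {z : Disc} {α β : ℝ} (h : (γ : Equiv.Perm SL2Cover) (mk α z) = mk (α + β) z)
    (α' : ℝ) : (γ : Equiv.Perm SL2Cover) (mk α' z) = mk (α' + β) z := by
  have hz : (p γ : Equiv.Perm Disc) z = z := by
    have := congrArg pt h
    rw [pt_apply] at this
    exact this
  have hp := mem_DePlus_of_fix hfree hγ hz
  have h1 := ang_apply_of_mem hp (mk α z)
  have h2 := ang_apply_of_mem hp (mk α' z)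
  rw [h] at h1
  simp only [ang_mk, pt_mk] at h1 h2
  exact SL2Cover.ext (by rw [h2, ang_mk]; linarith) ((pt_apply γ _).trans hz)

/-- The lengths by which elements of `Γ` translate the fibre over the point `z`. -/
def fibreShift (hfree : ∀ γ : Γ, ∀ x : SL2Cover, γ • x = x → γ = 1) (z : Disc) :
    AddSubgroup ℝ where
  carrier := {c | ∃ γ ∈ Γ, (γ : Equiv.Perm SL2Cover) (mk 0 z) = mk (0 + c) z}
  zero_mem' := ⟨1, one_mem _, by rw [add_zero]; rfl⟩
  add_mem' := by
    rintro a b ⟨γ, hγ, h1⟩ ⟨δ, hδ, h2⟩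
    refine ⟨γ * δ, mul_mem hγ hδ, ?_⟩
    change (γ : Equiv.Perm SL2Cover) ((δ : Equiv.Perm SL2Cover) (mk 0 z)) = _
    rw [h2, apply_mk_of_apply_mk hfree hγ h1]
    congr 1
    ring
  neg_mem' := by
    rintro a ⟨γ, hγ, h1⟩
    refine ⟨γ⁻¹, inv_mem hγ, ?_⟩
    have h2 := apply_mk_of_apply_mk hfree hγ h1 (-a)
    change (γ : Equiv.Perm SL2Cover)⁻¹ (mk 0 z) = _
    rw [Equiv.Perm.inv_eq_iff_eq, zero_add, h2, neg_add_cancel]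

/-- Proper discontinuity bounds the translation lengths along a fibre away from zero. -/
theorem exists_forall_apply_mk_ne [ProperlyDiscontinuousSMul Γ SL2Cover] (z : Disc) :
    ∃ ε > 0, ∀ γ ∈ Γ, ∀ c, 0 < c → c < ε →
      (γ : Equiv.Perm SL2Cover) (mk 0 z) ≠ mk (0 + c) z := by
  obtain ⟨U, hU, hU'⟩ :=
    ProperlyDiscontinuousSMul.exists_nhds_image_smul_eq_self Γ (mk 0 z)
  have hcont : Continuous fun c : ℝ => mk (0 + c) z :=
    continuous_mk.comp ((continuous_const.add continuous_id).prodMk continuous_const)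
  have hU0 : ∀ᶠ c in 𝓝 (0 : ℝ), mk (0 + c) z ∈ U := by
    refine hcont.continuousAt ?_
    rwa [add_zero]
  obtain ⟨ε, hε, hεU⟩ := Metric.eventually_nhds_iff.1 hU0
  refine ⟨ε, hε, fun γ hγ c hc0 hcε h => ?_⟩
  have hc : mk (0 + c) z ∈ U := hεU (by rw [Real.dist_0_eq_abs, abs_of_pos hc0]; exact hcε)
  have h1 := hU' ⟨γ, hγ⟩ ⟨_, ⟨_, mem_of_mem_nhds hU, rfl⟩, by
    change (γ : Equiv.Perm SL2Cover) (mk 0 z) ∈ U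
    rwa [h]⟩
  change (γ : Equiv.Perm SL2Cover) (mk 0 z) = mk 0 z at h1
  have h2 := congrArg ang (h.symm.trans h1)
  simp only [ang_mk] at h2
  linarith

/-- The translation lengths along a fibre form a cyclic group. -/
theorem exists_fibreShift_eq [ProperlyDiscontinuousSMul Γ SL2Cover]
    (hfree : ∀ γ : Γ, ∀ x : SL2Cover, γ • x = x → γ = 1) (z : Disc) :
    ∃ c, fibreShift hfree z = AddSubgroup.zmultiples c := by
  obtain ⟨ε, hε, h⟩ := exists_forall_apply_mk_ne (Γ := Γ) z
  obtain ⟨c, hc⟩ := AddSubgroup.cyclic_of_isolated_zero (H := fibreShift hfree z) hε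
    (Set.disjoint_left.2 fun c hc hc' => by
      obtain ⟨γ, hγ, hγc⟩ := hc
      exact h γ hγ c hc'.1 hc'.2 hγc)
  exact ⟨c, by rw [hc, AddSubgroup.zmultiples_eq_closure]⟩

/-- `Γ` contains a nontrivial translation: otherwise `p` would be injective on `Γ`, and by proper
discontinuity on the disc a whole noncompact fibre would be covered by finitely many translates of a
compact set. -/
theorem exists_trans_mem [ProperlyDiscontinuousSMul Γ SL2Cover] {C : Set SL2Cover}
    (hC : IsCompact C) (hCΓ : ∀ x : SL2Cover, ∃ γ : Γ, γ • x ∈ C) :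
    ∃ θ : ℝ, θ ≠ 0 ∧ trans (Multiplicative.ofAdd θ) ∈ Γ := by
  by_contra! hno
  have hinj : Set.InjOn p (Γ : Set De) := by
    intro γ hγ δ hδ h
    have h1 : p (γ⁻¹ * δ) = 1 := by rw [map_mul, map_inv, h, inv_mul_cancel]
    obtain ⟨θ, hθ⟩ := exists_eq_trans h1
    have h2 : θ.toAdd = 0 := by
      by_contra h3
      exact hno _ h3 (hθ ▸ mul_mem (inv_mem hγ) hδ)
    rw [show θ = 1 from h2, map_one, inv_mul_eq_one] at hθ
    exact hθ
  have hK : IsCompact (pt '' C) := hC.image continuous_pt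
  have hKΓ (z : Disc) : ∃ γ ∈ Γ, (p γ : Equiv.Perm Disc) z ∈ pt '' C := by
    obtain ⟨γ, hγ⟩ := hCΓ (mk 0 z)
    exact ⟨γ, γ.2, _, hγ, pt_smul (γ : De) _⟩
  obtain ⟨γ₀, hγ₀⟩ := hCΓ 1
  set z₀ := ((γ₀ : De) • (1 : SL2Cover)).pt
  have hz₀ : z₀ ∈ pt '' C := ⟨_, hγ₀, rfl⟩
  have hfin : {γ : De | γ ∈ Γ ∧ ((p γ : Equiv.Perm Disc) '' (pt '' C) ∩ pt '' C).Nonempty}.Finite :=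
    Set.Finite.of_finite_image ((finite_inter_image_map_p hK hKΓ hK).subset (by
      rintro _ ⟨γ, ⟨hγ, hne⟩, rfl⟩
      exact ⟨⟨γ, hγ, rfl⟩, hne⟩)) (hinj.mono fun γ hγ => hγ.1)
  have hcomp : IsCompact (⋃ γ ∈ {γ : De | γ ∈ Γ ∧
      ((p γ : Equiv.Perm Disc) '' (pt '' C) ∩ pt '' C).Nonempty},
        (fun x => (((γ⁻¹ : De) : Equiv.Perm SL2Cover) x).ang) '' C) :=
    hfin.isCompact_biUnion fun γ _ =>
      hC.image (continuous_ang.comp (contMDiff_of_mem_De (γ⁻¹).2).continuous)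
  -- the point at height `B + 1` over `z₀` would be covered by the translates
  obtain ⟨B, hB⟩ := hcomp.bddAbove
  obtain ⟨γ, hγ⟩ := hCΓ (mk (B + 1) z₀)
  have h1 := hB (Set.mem_biUnion (x := (γ : De)) ⟨γ.2, _,
    ⟨z₀, hz₀, rfl⟩, _, hγ, pt_smul (γ : De) _⟩ ⟨_, hγ, rfl⟩)
  have h2 : (((γ : De)⁻¹ : De) : Equiv.Perm SL2Cover) (γ • mk (B + 1) z₀) = mk (B + 1) z₀ :=
    ((γ : De) : Equiv.Perm SL2Cover).symm_apply_apply _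
  simp only [h2, ang_mk] at h1
  linarith

theorem isCyclic_inf_trans_range [ProperlyDiscontinuousSMul Γ SL2Cover] :
    IsCyclic ↥(Γ ⊓ trans.range) := by
  obtain ⟨ε, hε, h⟩ := exists_forall_apply_mk_ne (Γ := Γ) Disc.zero
  obtain ⟨b, hb⟩ := Subgroup.cyclic_of_isolated_one (H := Γ.comap trans)
    (a := Multiplicative.ofAdd ε) hε (Set.disjoint_left.2 fun c hc hc' => by
      exact h _ hc c.toAdd hc'.1 hc'.2 rfl)
  have h1 : Γ ⊓ trans.range = Subgroup.zpowers (trans b) := by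
    rw [inf_comm, ← Subgroup.map_comap_eq, hb, ← Subgroup.zpowers_eq_closure,
      MonoidHom.map_zpowers]
  rw [h1]
  infer_instance

theorem infinite_inf_trans_range {θ : ℝ} (hθ : θ ≠ 0)
    (h : trans (Multiplicative.ofAdd θ) ∈ Γ) : Infinite ↥(Γ ⊓ trans.range) := by
  refine Infinite.of_injective (fun n : ℤ => (⟨trans (Multiplicative.ofAdd θ) ^ n,
    Subgroup.mem_inf.2 ⟨zpow_mem h n, trans.range.zpow_mem ⟨_, rfl⟩ n⟩⟩ : ↥(Γ ⊓ trans.range)))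
    fun m n hmn => ?_
  have h1 := congrArg Subtype.val hmn
  simp only [← map_zpow, ← ofAdd_zsmul] at h1
  have h2 := congrArg (fun ψ : De => ((ψ : Equiv.Perm SL2Cover) 1).ang) h1
  simp only [trans_apply, ang_mk, one_ang, zero_add, zsmul_eq_mul] at h2
  exact_mod_cast mul_right_cancel₀ hθ h2

end Free

end De

/-! ### Local models of the fibration -/

namespace Disc

/-- The contraction `w ↦ ε w` of the disc, for `0 < ε ≤ 1`. -/
def scale (ε : ℝ) (h0 : 0 < ε) (h1 : ε ≤ 1) (w : Disc) : Disc :=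
  mk (ε * w) (by
    rw [normSq_mul, normSq_ofReal]
    nlinarith [normSq_lt w, normSq_nonneg (w : ℂ), mul_le_one₀ h1 h0.le h1])

section Scale

variable {ε : ℝ} (h0 : 0 < ε) (h1 : ε ≤ 1)

@[simp] theorem coe_scale (w : Disc) : (scale ε h0 h1 w : ℂ) = ε * w := rfl

theorem scale_injective : Function.Injective (scale ε h0 h1) := by
  intro w w' h
  have h2 := congrArg (fun z : Disc => (z : ℂ)) h
  simp only [coe_scale] at h2
  exact Subtype.ext (mul_left_cancel₀ (ofReal_ne_zero.2 h0.ne') h2)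

theorem scale_rot (φ : ℝ) (w : Disc) : scale ε h0 h1 (rot φ w) = rot φ (scale ε h0 h1 w) :=
  Subtype.ext (by simp only [coe_scale, coe_rot]; ring)

@[simp] theorem scale_zero : scale ε h0 h1 zero = zero := Subtype.ext (by simp [zero])

theorem contMDiff_scale : ContMDiff 𝓘(ℝ, ℂ) 𝓘(ℝ, ℂ) ∞ (scale ε h0 h1) := by
  rw [contMDiff_iff_coe]
  have h : ContDiff ℝ ∞ fun w : ℂ => (ε : ℂ) * w := by fun_prop
  exact h.comp_contMDiff contMDiff_coe

open Classical in
/-- The inverse of `scale` on its range, extended by the centre of the disc. -/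
def unscale (ε : ℝ) (z : Disc) : Disc :=
  if h : normSq ((ε : ℂ)⁻¹ * z) < 1 then mk ((ε : ℂ)⁻¹ * z) h else zero

theorem coe_unscale {z : Disc} (h : normSq ((ε : ℂ)⁻¹ * z) < 1) :
    (unscale ε z : ℂ) = (ε : ℂ)⁻¹ * z := by
  rw [unscale, dif_pos h, coe_mk]

theorem normSq_inv_mul_scale (w : Disc) :
    normSq ((ε : ℂ)⁻¹ * (scale ε h0 h1 w : ℂ)) < 1 := by
  rw [coe_scale, inv_mul_cancel_left₀ (ofReal_ne_zero.2 h0.ne')]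
  exact normSq_lt w

theorem unscale_scale (w : Disc) : unscale ε (scale ε h0 h1 w) = w := by
  refine Subtype.ext ?_
  rw [coe_unscale (normSq_inv_mul_scale h0 h1 w), coe_scale,
    inv_mul_cancel_left₀ (ofReal_ne_zero.2 h0.ne')]

theorem scale_unscale {z : Disc} (h : normSq ((ε : ℂ)⁻¹ * z) < 1) :
    scale ε h0 h1 (unscale ε z) = z := by
  refine Subtype.ext ?_
  rw [coe_scale, coe_unscale h, mul_inv_cancel_left₀ (ofReal_ne_zero.2 h0.ne')]

theorem isOpen_normSq_inv_mul : IsOpen {z : Disc | normSq ((ε : ℂ)⁻¹ * z) < 1} :=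
  isOpen_lt (continuous_normSq.comp (by fun_prop)) continuous_const

theorem contMDiffOn_unscale :
    ContMDiffOn 𝓘(ℝ, ℂ) 𝓘(ℝ, ℂ) ∞ (unscale ε) {z : Disc | normSq ((ε : ℂ)⁻¹ * z) < 1} := by
  intro z hz
  rw [← ContMDiffWithinAt.subtypeVal_comp_iff Disc]
  have h : ContDiff ℝ ∞ fun w : ℂ => (ε : ℂ)⁻¹ * w := by fun_prop
  exact ((h.comp_contMDiff contMDiff_coe).contMDiffAt.contMDiffWithinAt).congr
    (fun y hy => coe_unscale hy) (coe_unscale hz)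

theorem isLocalDiffeomorph_scale :
    IsLocalDiffeomorph 𝓘(ℝ, ℂ) 𝓘(ℝ, ℂ) ∞ (scale ε h0 h1) := by
  intro w
  exact ⟨{
    toFun := scale ε h0 h1
    invFun := unscale ε
    source := Set.univ
    target := {z : Disc | normSq ((ε : ℂ)⁻¹ * z) < 1}
    map_source' := fun w _ => normSq_inv_mul_scale h0 h1 w
    map_target' := fun _ _ => Set.mem_univ _
    left_inv' := fun w _ => unscale_scale h0 h1 w
    right_inv' := fun _ hz => scale_unscale h0 h1 hz
    open_source := isOpen_univ
    open_target := isOpen_normSq_inv_mul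
    contMDiffOn_toFun := (contMDiff_scale h0 h1).contMDiffOn
    contMDiffOn_invFun := contMDiffOn_unscale }, Set.mem_univ _, fun _ _ => rfl⟩

/-- The product of a contraction of the disc and a dilation of the line, as a map to the universal
cover. -/
theorem isLocalDiffeomorph_mk_scale {c : ℝ} (hc : c ≠ 0) :
    IsLocalDiffeomorph (𝓘(ℝ, ℂ).prod 𝓘(ℝ, ℝ)) (𝓘(ℝ, ℝ).prod 𝓘(ℝ, ℂ)) ∞
      (fun q : Disc × ℝ => SL2Cover.mk (c * q.2) (scale ε h0 h1 q.1)) := by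
  intro w
  have hfst : ContMDiff (𝓘(ℝ, ℂ).prod 𝓘(ℝ, ℝ)) 𝓘(ℝ, ℂ) ∞ (Prod.fst : Disc × ℝ → Disc) :=
    contMDiff_fst
  have hsnd : ContMDiff (𝓘(ℝ, ℂ).prod 𝓘(ℝ, ℝ)) 𝓘(ℝ, ℝ) ∞ (Prod.snd : Disc × ℝ → ℝ) :=
    contMDiff_snd
  have hdiv : ContMDiff (𝓘(ℝ, ℝ).prod 𝓘(ℝ, ℂ)) 𝓘(ℝ, ℝ) ∞
      (fun x : SL2Cover => c⁻¹ * x.ang) := contMDiff_const.mul SL2Cover.contMDiff_ang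
  exact ⟨{
    toFun := fun q => SL2Cover.mk (c * q.2) (scale ε h0 h1 q.1)
    invFun := fun x => (unscale ε x.pt, c⁻¹ * x.ang)
    source := Set.univ
    target := SL2Cover.pt ⁻¹' {z : Disc | normSq ((ε : ℂ)⁻¹ * z) < 1}
    map_source' := fun w _ => normSq_inv_mul_scale h0 h1 w.1
    map_target' := fun _ _ => Set.mem_univ _
    left_inv' := fun w _ => Prod.ext (unscale_scale h0 h1 w.1) (inv_mul_cancel_left₀ hc _)
    right_inv' := fun _ hz =>
      SL2Cover.ext (mul_inv_cancel_left₀ hc _) (scale_unscale h0 h1 hz)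
    open_source := isOpen_univ
    open_target := isOpen_normSq_inv_mul.preimage SL2Cover.continuous_pt
    contMDiffOn_toFun := ((contMDiff_const.mul hsnd).sl2CoverMk
      ((contMDiff_scale h0 h1).comp hfst)).contMDiffOn
    contMDiffOn_invFun := (contMDiffOn_unscale.comp SL2Cover.contMDiff_pt.contMDiffOn
      (fun _ h => h)).prodMk hdiv.contMDiffOn }, Set.mem_univ _, fun _ _ => rfl⟩

/-- The images of the contractions `w ↦ ε w` shrink to the centre. -/
theorem exists_scale_mem {U : Set Disc} (hU : U ∈ 𝓝 zero) :
    ∃ (ε : ℝ) (h0 : 0 < ε) (h1 : ε ≤ 1), ∀ w, scale ε h0 h1 w ∈ U := by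
  rw [nhds_subtype_eq_comap, Filter.mem_comap] at hU
  obtain ⟨V, hV, hVU⟩ := hU
  obtain ⟨δ, hδ, hδV⟩ := Metric.mem_nhds_iff.1 hV
  refine ⟨min δ 1, lt_min hδ one_pos, min_le_right _ _, fun w => hVU (hδV ?_)⟩
  change (min δ 1 : ℝ) * (w : ℂ) ∈ Metric.ball (0 : ℂ) δ
  rw [mem_ball_zero_iff, norm_mul, norm_real, Real.norm_of_nonneg (lt_min hδ one_pos).le]
  calc min δ 1 * ‖(w : ℂ)‖ < min δ 1 * 1 :=
        mul_lt_mul_of_pos_left (norm_lt w) (lt_min hδ one_pos)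
    _ ≤ δ := by rw [mul_one]; exact min_le_left _ _

end Scale

end Disc

namespace SL2Cover

/-- Left translation as a diffeomorphism. -/
def mulLeftDiffeo (g : SL2Cover) : SL2Cover ≃ₘ^∞⟮𝓘(ℝ, ℝ).prod 𝓘(ℝ, ℂ), 𝓘(ℝ, ℝ).prod 𝓘(ℝ, ℂ)⟯
    SL2Cover where
  toEquiv := Equiv.mulLeft g
  contMDiff_toFun := contMDiff_mul_left g
  contMDiff_invFun := contMDiff_mul_left g⁻¹

theorem mob_inv_mob (g : SL2Cover) (z : Disc) :
    Disc.mob (g⁻¹).ang (g⁻¹).pt (Disc.mob g.ang g.pt z) = z := by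
  rw [← mob_mul, inv_mul_cancel]
  exact Disc.mob_zero_zero z

/-- The isometry of the disc under an element of the universal cover, as a diffeomorphism. -/
def mobDiffeo (g : SL2Cover) : Disc ≃ₘ^∞⟮𝓘(ℝ, ℂ), 𝓘(ℝ, ℂ)⟯ Disc where
  toFun := Disc.mob g.ang g.pt
  invFun := Disc.mob (g⁻¹).ang (g⁻¹).pt
  left_inv := mob_inv_mob g
  right_inv z := by
    have := mob_inv_mob g⁻¹ z
    rwa [inv_inv] at this
  contMDiff_toFun := Disc.contMDiff_mob _ _
  contMDiff_invFun := Disc.contMDiff_mob _ _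

theorem mk_zero_mul_mk_zero (z : Disc) (α : ℝ) : mk 0 z * mk α Disc.zero = mk α z := by
  refine SL2Cover.ext ?_ ?_
  · simp [Disc.den, Disc.zero]
  · rw [mul_pt]
    exact Disc.mob_apply_zero _ _

end SL2Cover

/-- A Hausdorff space parametrised by the line modulo integer translations is a circle. -/
theorem nonempty_homeomorph_circle {Y : Type*} [TopologicalSpace Y] [T2Space Y] {ρ : ℝ → Y}
    (hc : Continuous ρ) (hs : Function.Surjective ρ)
    (hρ : ∀ s s', ρ s = ρ s' ↔ ∃ n : ℤ, s' = s + n) : Nonempty (Y ≃ₜ Circle) := by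
  have hper : Function.Periodic ρ 1 := fun s => ((hρ s (s + 1)).2 ⟨1, by simp⟩).symm
  have hlift : Continuous (hper.lift : AddCircle (1 : ℝ) → Y) := continuous_coinduced_dom.2 hc
  have hbij : Function.Bijective (hper.lift : AddCircle (1 : ℝ) → Y) := by
    constructor
    · intro a b
      induction a using QuotientAddGroup.induction_on with | H s => ?_
      induction b using QuotientAddGroup.induction_on with | H s' => ?_
      intro h
      obtain ⟨n, hn⟩ := (hρ s s').1 h
      rw [hn, QuotientAddGroup.eq]
      exact ⟨n, by simp⟩
    · intro y
      obtain ⟨s, rfl⟩ := hs y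
      exact ⟨s, rfl⟩
  have : Fact ((0 : ℝ) < 1) := ⟨one_pos⟩
  exact ⟨(Continuous.homeoOfEquivCompactToT2 (f := Equiv.ofBijective _ hbij) hlift).symm.trans
    (AddCircle.homeomorphCircle one_ne_zero)⟩

/-! ### Solid tori around the fibres -/

open SL2Cover

namespace De

/-- If `γ` translates the fibre over `z` by `c`, then `γ` is a screw motion along this fibre. -/
theorem exists_screw {γ : De} (hγ : (γ : Equiv.Perm SL2Cover) ∈ DePlus) {z : Disc} {c : ℝ}
    (h : (γ : Equiv.Perm SL2Cover) (mk 0 z) = mk c z) :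
    ∃ φ : ℝ, ∀ (α : ℝ) (w : Disc), (γ : Equiv.Perm SL2Cover) (mk 0 z * mk α w) =
      mk 0 z * mk (α + c) (Disc.rot φ w) := by
  obtain ⟨θ, g, hg⟩ := hγ
  set g' := (mk 0 z)⁻¹ * g * mk 0 z with hg'
  -- conjugation by the left translation taking the centre to `z`
  have hconj (x : SL2Cover) : (γ : Equiv.Perm SL2Cover) (mk 0 z * x) =
      mk 0 z * transPerm θ (g' * x) := by
    have h1 : g * (mk 0 z * x) = mk 0 z * (g' * x) := by rw [hg']; group
    have h2 := DFunLike.congr_fun (transPerm_mul_mulLeft θ (mk 0 z)) (g' * x)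
    rw [hg]
    change transPerm θ (g * (mk 0 z * x)) = _
    rw [h1]
    exact h2
  have h3 : transPerm θ g' = mk c Disc.zero := by
    have h4 := hconj 1
    rw [mul_one, mul_one, h, ← mk_zero_mul_mk_zero] at h4
    exact (mul_left_cancel h4).symm
  have hpt : g'.pt = Disc.zero := congrArg pt h3
  have hang : g'.ang + θ = c := congrArg ang h3
  refine ⟨g'.ang, fun α w => ?_⟩
  rw [hconj]
  congr 1
  refine SL2Cover.ext ?_ ?_
  · change g'.ang + α - 2 * arg (Disc.den g'.ang g'.pt w) + θ = α + c
    rw [hpt, ← hang]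
    simp only [Disc.den, Disc.zero, Disc.coe_mk, map_zero, zero_mul, add_zero, arg_one, mul_zero]
    ring
  · change Disc.mob g'.ang g'.pt w = _
    rw [hpt, Disc.mob_zero_right, pt_mk]

theorem zpow_screw {γ : De} {k : SL2Cover} {c φ : ℝ}
    (h : ∀ (α : ℝ) (w : Disc), (γ : Equiv.Perm SL2Cover) (k * mk α w) =
      k * mk (α + c) (Disc.rot φ w))
    (n : ℤ) : ∀ (α : ℝ) (w : Disc), ((γ ^ n : De) : Equiv.Perm SL2Cover) (k * mk α w) =
      k * mk (α + n * c) (Disc.rot (φ * n) w) := by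
  have hrot (a b : ℝ) (w : Disc) : Disc.rot a (Disc.rot b w) = Disc.rot (a + b) w :=
    Subtype.ext (by simp [Disc.unit_add, mul_assoc])
  have hrot0 (w : Disc) : Disc.rot 0 w = w := Subtype.ext (by simp)
  have hinv (α : ℝ) (w : Disc) : ((γ⁻¹ : De) : Equiv.Perm SL2Cover) (k * mk α w) =
      k * mk (α - c) (Disc.rot (-φ) w) := by
    change (γ : Equiv.Perm SL2Cover)⁻¹ _ = _
    rw [Equiv.Perm.inv_eq_iff_eq, h, hrot, add_neg_cancel, hrot0, sub_add_cancel]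
  induction n with
  | zero =>
    intro α w
    simp only [Int.cast_zero, zero_mul, add_zero, mul_zero, hrot0]
    rfl
  | succ n ih =>
    intro α w
    rw [zpow_add_one]
    change ((γ ^ (n : ℤ) : De) : Equiv.Perm SL2Cover) ((γ : Equiv.Perm SL2Cover) (k * mk α w)) = _
    rw [h, ih, hrot]
    push_cast
    congr 2 <;> ring_nf
  | pred n ih =>
    intro α w
    rw [zpow_sub_one]
    change ((γ ^ (-(n : ℤ)) : De) : Equiv.Perm SL2Cover)
      (((γ⁻¹ : De) : Equiv.Perm SL2Cover) (k * mk α w)) = _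
    rw [hinv, ih, hrot]
    push_cast
    congr 2 <;> ring_nf

variable {Γ : Subgroup De}

/-- The stabiliser of the fibre over `z` is generated by a screw motion of rational angle: some
power of the generator is a pure translation. -/
theorem exists_generator [ProperlyDiscontinuousSMul Γ SL2Cover]
    (hfree : ∀ γ : Γ, ∀ x : SL2Cover, γ • x = x → γ = 1) {θ : ℝ} (hθ : θ ≠ 0)
    (hθΓ : trans (Multiplicative.ofAdd θ) ∈ Γ) (z : Disc) :
    ∃ (c : ℝ) (ν : ℚ), c ≠ 0 ∧ ∃ γ ∈ Γ,
      (∀ (n : ℤ) (α : ℝ) (w : Disc), ((γ ^ n : De) : Equiv.Perm SL2Cover) (mk 0 z * mk α w) =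
        mk 0 z * mk (α + n * c) (Disc.rot (2 * Real.pi * ν * n) w)) ∧
      ∀ δ ∈ Γ, (p δ : Equiv.Perm Disc) z = z → ∃ n : ℤ, δ = γ ^ n := by
  obtain ⟨c, hc⟩ := exists_fibreShift_eq hfree z
  obtain ⟨γ, hγ, hγc⟩ : c ∈ fibreShift hfree z := hc ▸ AddSubgroup.mem_zmultiples c
  rw [zero_add] at hγc
  have hfix : (p γ : Equiv.Perm Disc) z = z := by
    have := congrArg pt hγc
    rw [pt_apply] at this
    exact this
  obtain ⟨φ, hφ⟩ := exists_screw (mem_DePlus_of_fix hfree hγ hfix) hγc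
  have hpow := zpow_screw hφ
  have hgen (δ : De) (hδ : δ ∈ Γ) (hz : (p δ : Equiv.Perm Disc) z = z) :
      ∃ n : ℤ, ((δ : Equiv.Perm SL2Cover) (mk 0 z)).ang = n * c ∧ δ = γ ^ n := by
    have h1 : (δ : Equiv.Perm SL2Cover) (mk 0 z) =
        mk (0 + ((δ : Equiv.Perm SL2Cover) (mk 0 z)).ang) z :=
      SL2Cover.ext (zero_add _).symm ((pt_apply δ _).trans hz)
    have h2 : ((δ : Equiv.Perm SL2Cover) (mk 0 z)).ang ∈ fibreShift hfree z := ⟨δ, hδ, h1⟩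
    rw [hc] at h2
    obtain ⟨n, hn⟩ := AddSubgroup.mem_zmultiples_iff.1 h2
    rw [zsmul_eq_mul] at hn
    refine ⟨n, hn.symm, ?_⟩
    have h3 := hpow n 0 Disc.zero
    rw [Disc.rot_zero_apply, mk_zero_mul_mk_zero, mk_zero_mul_mk_zero, hn, ← h1] at h3
    have h4 : (⟨(γ ^ n)⁻¹ * δ, mul_mem (inv_mem (zpow_mem hγ n)) hδ⟩ : Γ) • mk 0 z = mk 0 z := by
      change ((γ ^ n : De) : Equiv.Perm SL2Cover)⁻¹ ((δ : Equiv.Perm SL2Cover) (mk 0 z)) = _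
      rw [Equiv.Perm.inv_eq_iff_eq, h3]
    have h5 := congrArg Subtype.val (hfree _ _ h4)
    exact (inv_mul_eq_one.1 h5).symm
  -- the translation by `θ` is a power of the generator, without rotation part
  obtain ⟨m, hm1, hm2⟩ := hgen _ hθΓ rfl
  have hm3 : θ = m * c := by
    rw [← hm1, trans_apply, ang_mk, ang_mk, zero_add]
  have hm0 : (m : ℝ) ≠ 0 := fun h => hθ (by rw [hm3, h, zero_mul])
  have hc0 : c ≠ 0 := fun h => hθ (by rw [hm3, h, mul_zero])
  have hrot : Disc.unit (φ * m) = 1 := by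
    set w : Disc := Disc.mk (1 / 2) (by norm_num [normSq]) with hw
    have h1 := hpow m 0 w
    rw [← hm2, trans_apply] at h1
    have h2 : Disc.mob 0 z w = Disc.mob 0 z (Disc.rot (φ * m) w) := congrArg pt h1
    have h3 := congrArg (fun z : Disc => (z : ℂ)) ((mobDiffeo (mk 0 z)).injective h2)
    simp only [hw, Disc.coe_rot, Disc.coe_mk] at h3
    linear_combination -2 * h3
  obtain ⟨l, hl⟩ := Disc.unit_eq_one_iff.1 hrot
  have hν : φ = 2 * Real.pi * ((l / m : ℚ) : ℝ) := by
    push_cast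
    field_simp
    linarith
  refine ⟨c, l / m, hc0, γ, hγ, fun n α w => ?_, fun δ hδ hz => ?_⟩
  · rw [hpow, hν]
  · obtain ⟨n, -, hn⟩ := hgen δ hδ hz
    exact ⟨n, hn⟩

/-! ### The projection of the quotient to its base -/

/-- The projection of the quotient of the universal cover by `Γ` to the quotient of the disc by
`p(Γ)`. -/
def baseMap (Γ : Subgroup De) : MulAction.orbitRel.Quotient Γ SL2Cover →
    MulAction.orbitRel.Quotient (Γ.map p) Disc :=
  Quotient.map pt (by
    rintro x y ⟨γ, rfl⟩
    exact ⟨⟨p γ, γ, γ.2, rfl⟩, (pt_smul (γ : De) y).symm⟩)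

instance : ContinuousConstSMul (Γ.map p) Disc where
  continuous_const_smul := by
    rintro ⟨_, γ, hγ, rfl⟩
    exact continuous_p γ

/-- The composition of the orbit projections of the cover and of the disc is open and factors
through `baseMap`. -/
theorem isQuotientMap_baseMap : IsQuotientMap (baseMap Γ) := by
  have h1 : IsOpenQuotientMap (Quotient.mk (MulAction.orbitRel (Γ.map p) Disc)) :=
    MulAction.isOpenQuotientMap_quotientMk
  have h2 : IsOpenQuotientMap pt :=
    ⟨fun z => ⟨mk 0 z, rfl⟩, continuous_pt, isOpenMap_snd (X := ℝ) (Y := Disc)⟩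
  have hc : Continuous (baseMap Γ) := (h1.continuous.comp h2.continuous).quotient_lift _
  exact IsQuotientMap.of_comp continuous_quotient_mk' hc (h1.comp h2).isQuotientMap

/-- The space of fibres is homeomorphic to the quotient of the disc by `p(Γ)`. -/
def baseHomeo (Γ : Subgroup De) : Quotient (Setoid.ker (baseMap Γ)) ≃ₜ
    MulAction.orbitRel.Quotient (Γ.map p) Disc :=
  IsHomeomorph.homeomorph (Setoid.kerLift (baseMap Γ))
    (isHomeomorph_iff_isQuotientMap_injective.2 ⟨IsQuotientMap.of_comp continuous_quotient_mk'
      (isQuotientMap_baseMap.continuous.quotient_lift _) isQuotientMap_baseMap,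
      Setoid.kerLift_injective _⟩)

/-- The points over the orbit of `z` are represented on the fibre over `z`. -/
theorem exists_mk_eq_of_baseMap_eq {a : MulAction.orbitRel.Quotient Γ SL2Cover} {z : Disc}
    (h : baseMap Γ a = Quotient.mk _ z) : ∃ α, a = Quotient.mk _ (mk α z) := by
  induction a using Quotient.inductionOn with | h x => ?_
  obtain ⟨⟨_, γ, hγ, rfl⟩, hz⟩ := MulAction.orbitRel_apply.1 (Quotient.exact h.symm)
  change (p γ : Equiv.Perm Disc) x.pt = z at hz
  refine ⟨((γ : Equiv.Perm SL2Cover) x).ang, (Quotient.sound ⟨⟨γ, hγ⟩, ?_⟩ :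
    (Quotient.mk (MulAction.orbitRel Γ SL2Cover) (mk _ z)) = Quotient.mk _ x).symm⟩
  exact SL2Cover.ext rfl ((pt_apply γ x).trans hz)

/-- Every point has a fibred solid torus around its fibre, centred at the fibre, whose cross section
is carried diffeomorphically into the disc. -/
theorem exists_isFibredSolidTorus [ProperlyDiscontinuousSMul Γ SL2Cover] [IsCancelSMul Γ SL2Cover]
    [ProperlyDiscontinuousSMul (Γ.map p) Disc]
    (hfree : ∀ γ : Γ, ∀ x : SL2Cover, γ • x = x → γ = 1) {θ : ℝ} (hθ : θ ≠ 0)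
    (hθΓ : trans (Multiplicative.ofAdd θ) ∈ Γ) (x : MulAction.orbitRel.Quotient Γ SL2Cover) :
    ∃ (ν : ℚ) (Ψ : Disc × ℝ → MulAction.orbitRel.Quotient Γ SL2Cover) (σ : Disc → Disc),
      IsFibredSolidTorus (𝓘(ℝ, ℝ).prod 𝓘(ℝ, ℂ)) (Setoid.ker (baseMap Γ)) ν Ψ ∧
      IsLocalDiffeomorph 𝓘(ℝ, ℂ) 𝓘(ℝ, ℂ) ∞ σ ∧ Function.Injective σ ∧
      (∀ w s, baseMap Γ (Ψ (w, s)) = Quotient.mk _ (σ w)) ∧ ∃ s, Ψ (Disc.zero, s) = x := by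
  induction x using Quotient.inductionOn with | h x => ?_
  set z := x.pt with hz
  obtain ⟨c, ν, hc, γ, hγ, hpow, hgen⟩ := exists_generator hfree hθ hθΓ z
  -- the cross section is a disc around `z` inside a neighbourhood `U` meeting only those of its
  -- images which come from the stabiliser of `z`
  obtain ⟨U, hU, hU'⟩ :=
    ProperlyDiscontinuousSMul.exists_nhds_image_smul_eq_self (Γ.map p) z
  have hU0 : Disc.mob 0 z ⁻¹' U ∈ 𝓝 Disc.zero := by
    refine (Disc.contMDiff_mob 0 z).continuous.continuousAt ?_
    rwa [Disc.mob_apply_zero]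
  obtain ⟨ε, h0, h1, hε⟩ := Disc.exists_scale_mem hU0
  have hinj : Function.Injective (Disc.mob 0 z) := (mobDiffeo (mk 0 z)).injective
  set S := Disc.scale ε h0 h1
  set Ψ : Disc × ℝ → MulAction.orbitRel.Quotient Γ SL2Cover :=
    fun q => Quotient.mk _ (mk 0 z * mk (c * q.2) (S q.1)) with hΨ
  have hbase (w : Disc) (s : ℝ) : baseMap Γ (Ψ (w, s)) = Quotient.mk _ (Disc.mob 0 z (S w)) := rfl
  have hsurj (w : Disc) (α : ℝ) : ∃ s, mk 0 z * mk (c * s) (S w) = mk α (Disc.mob 0 z (S w)) := by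
    refine ⟨c⁻¹ * (α + 2 * arg (Disc.den 0 z (S w))), SL2Cover.ext ?_ rfl⟩
    rw [mul_inv_cancel_left₀ hc, mul_ang]
    simp only [ang_mk, pt_mk]
    ring
  refine ⟨ν, Ψ, fun w => Disc.mob 0 z (S w), ⟨?_, ?_, ?_⟩, ?_, ?_, hbase, ?_⟩
  · intro q
    exact ((Disc.isLocalDiffeomorph_mk_scale h0 h1 hc q).comp _ _
      ((mulLeftDiffeo (mk 0 z)).isLocalDiffeomorph _)).comp _ _
        (isLocalDiffeomorph_quotientMk (fun g : Γ => contMDiff_of_mem_De (g : De).2) _)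
  · intro w s w' s'
    constructor
    · intro h
      obtain ⟨δ, hδ⟩ := MulAction.orbitRel_apply.1 (Quotient.exact h.symm)
      change ((δ : De) : Equiv.Perm SL2Cover) (mk 0 z * mk (c * s) (S w)) =
        mk 0 z * mk (c * s') (S w') at hδ
      have h2 : (p δ : Equiv.Perm Disc) (Disc.mob 0 z (S w)) = Disc.mob 0 z (S w') := by
        have := congrArg pt hδ
        rw [pt_apply] at this
        exact this
      have h3 : (p δ : Equiv.Perm Disc) z = z :=
        hU' ⟨p δ, δ, δ.2, rfl⟩ ⟨_, ⟨_, hε w, h2⟩, hε w'⟩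
      obtain ⟨n, hn⟩ := hgen δ δ.2 h3
      rw [hn, hpow] at hδ
      have h4 := mul_left_cancel hδ
      refine ⟨n, ?_, ?_⟩
      · have h5 : Disc.rot (2 * Real.pi * ν * n) (S w) = S w' := congrArg pt h4
        rw [← Disc.scale_rot] at h5
        exact (Disc.scale_injective h0 h1 h5).symm
      · have h5 : c * s + n * c = c * s' := congrArg ang h4
        apply mul_left_cancel₀ hc
        linear_combination -h5
    · rintro ⟨n, rfl, rfl⟩
      refine (Quotient.sound ⟨⟨γ ^ n, zpow_mem hγ n⟩, ?_⟩ : Ψ _ = Ψ _).symm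
      change ((γ ^ n : De) : Equiv.Perm SL2Cover) (mk 0 z * mk (c * s) (S w)) = _
      rw [hpow, ← Disc.scale_rot]
      congr 2
      ring
  · intro w s y
    rw [Setoid.ker_def, hbase]
    constructor
    · intro h
      obtain ⟨α, rfl⟩ := exists_mk_eq_of_baseMap_eq h.symm
      obtain ⟨s', hs'⟩ := hsurj w α
      exact ⟨s', congrArg (Quotient.mk _) hs'⟩
    · rintro ⟨s', rfl⟩
      exact (hbase w s').symm
  · intro w
    exact (Disc.isLocalDiffeomorph_scale h0 h1 w).comp _ _
      ((mobDiffeo (mk 0 z)).isLocalDiffeomorph _)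
  · exact hinj.comp (Disc.scale_injective h0 h1)
  · refine ⟨c⁻¹ * x.ang, congrArg (Quotient.mk _) ?_⟩
    change mk 0 z * mk (c * (c⁻¹ * x.ang)) (S Disc.zero) = x
    rw [mul_inv_cancel_left₀ hc, show S Disc.zero = Disc.zero from Disc.scale_zero h0 h1,
      mk_zero_mul_mk_zero]
    rfl

end De

open De

theorem mainTheorem5 (Γ : Subgroup De)
    (hfree : ∀ γ : Γ, ∀ x : SL2Cover, γ • x = x → γ = 1)
    (hpd : ProperlyDiscontinuousSMul Γ SL2Cover)
    (hcompact : CompactSpace (MulAction.orbitRel.Quotient Γ SL2Cover)) :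
    DiscreteTopology (Γ.map De.p) ∧
    CompactSpace (MulAction.orbitRel.Quotient (Γ.map De.p) Disc) ∧
    (IsCyclic ↥(Γ ⊓ De.trans.range) ∧ Infinite ↥(Γ ⊓ De.trans.range)) ∧
    ∃ _ : ChartedSpace (ModelProd ℝ ℂ) (MulAction.orbitRel.Quotient Γ SL2Cover),
      T2Space (MulAction.orbitRel.Quotient Γ SL2Cover) ∧
      SecondCountableTopology (MulAction.orbitRel.Quotient Γ SL2Cover) ∧
      IsManifold (𝓘(ℝ, ℝ).prod 𝓘(ℝ, ℂ)) ∞ (MulAction.orbitRel.Quotient Γ SL2Cover) ∧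
      IsLocalDiffeomorph (𝓘(ℝ, ℝ).prod 𝓘(ℝ, ℂ)) (𝓘(ℝ, ℝ).prod 𝓘(ℝ, ℂ)) ∞
        (fun x : SL2Cover => (Quotient.mk _ x : MulAction.orbitRel.Quotient Γ SL2Cover)) ∧
      ∃ r : Setoid (MulAction.orbitRel.Quotient Γ SL2Cover),
        IsSeifertFibration (𝓘(ℝ, ℝ).prod 𝓘(ℝ, ℂ)) r ∧
        HasBaseOrbifold (𝓘(ℝ, ℝ).prod 𝓘(ℝ, ℂ)) r (Γ.map De.p) := by
  have hcancel : IsCancelSMul Γ SL2Cover := isCancelSMul_iff_eq_one_of_smul_eq.2 hfree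
  have hsm : ∀ γ : Γ, ContMDiff (𝓘(ℝ, ℝ).prod 𝓘(ℝ, ℂ)) (𝓘(ℝ, ℝ).prod 𝓘(ℝ, ℂ)) ∞
      (fun x : SL2Cover => γ • x) := fun γ => contMDiff_of_mem_De (γ : De).2
  obtain ⟨C, hC, hCΓ⟩ := exists_isCompact_smul_mem Γ SL2Cover
  have hK₀ : IsCompact (pt '' C) := hC.image continuous_pt
  have hKΓ (z : Disc) : ∃ γ ∈ Γ, (p γ : Equiv.Perm Disc) z ∈ pt '' C := by
    obtain ⟨γ, hγ⟩ := hCΓ (mk 0 z)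
    exact ⟨γ, γ.2, _, hγ, pt_smul (γ : De) _⟩
  have hfin (K : Set Disc) (hK : IsCompact K) := finite_inter_image_map_p hK₀ hKΓ hK
  have hpd' : ProperlyDiscontinuousSMul (Γ.map p) Disc := ⟨fun {K L} hK hL => by
    refine Set.Finite.of_finite_image ((hfin _ (hK.union hL)).subset ?_)
      Subtype.val_injective.injOn
    rintro _ ⟨f, ⟨_, ⟨w, hw, rfl⟩, hfw⟩, rfl⟩
    exact ⟨f.2, _, ⟨w, Or.inl hw, rfl⟩, Or.inr hfw⟩⟩
  obtain ⟨θ, hθ, hθΓ⟩ := exists_trans_mem hC hCΓ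
  have htorus := exists_isFibredSolidTorus hfree hθ hθΓ
  refine ⟨discreteTopology_of_finite hfin, ?_, ⟨isCyclic_inf_trans_range,
    infinite_inf_trans_range hθ hθΓ⟩, inferInstance,
    t2Space_of_properlyDiscontinuousSMul_of_t2Space,
    ContinuousConstSMul.secondCountableTopology, isManifold_orbitRelQuotient hsm,
    isLocalDiffeomorph_quotientMk hsm, Setoid.ker (baseMap Γ), ⟨fun x => ?_, fun x => ?_⟩,
    baseHomeo Γ, fun x => ?_⟩
  · exact isQuotientMap_baseMap.surjective.compactSpace isQuotientMap_baseMap.continuous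
  · obtain ⟨ν, Ψ, σ, hΨ, -, -, -, s₀, rfl⟩ := htorus x
    -- the central fibre of the solid torus is fixed by the rotation of the cross section
    have : T2Space (MulAction.orbitRel.Quotient Γ SL2Cover) :=
      t2Space_of_properlyDiscontinuousSMul_of_t2Space
    refine nonempty_homeomorph_circle (ρ := fun s => (⟨Ψ (Disc.zero, s),
      (hΨ.fibre_iff _ _ _).2 ⟨s, rfl⟩⟩ : {y | Setoid.ker (baseMap Γ) (Ψ (Disc.zero, s₀)) y}))
      ?_ ?_ ?_
    · exact (hΨ.isLocalDiffeomorph.contMDiff.continuous.comp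
        (continuous_const.prodMk continuous_id)).subtype_mk _
    · rintro ⟨y, hy⟩
      obtain ⟨s, rfl⟩ := (hΨ.fibre_iff _ _ _).1 hy
      exact ⟨s, rfl⟩
    · intro s s'
      rw [Subtype.mk.injEq, hΨ.eq_iff]
      simp
  · obtain ⟨ν, Ψ, σ, hΨ, -, -, -, s₀, rfl⟩ := htorus x
    refine ⟨ν, Ψ, hΨ, fun y hy => ?_⟩
    obtain ⟨s, rfl⟩ := (hΨ.fibre_iff _ _ _).1 hy
    exact ⟨_, rfl⟩
  · obtain ⟨ν, Ψ, σ, hΨ, hσ, hσ', hb, s₀, hs₀⟩ := htorus x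
    exact ⟨ν, Ψ, σ, hΨ, ⟨_, hs₀⟩, hσ, hσ', fun w => hb w 0⟩

end
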